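/- Let $\Omega\subset\mathbb C$ be a simply connected domain. A complex-valued harmonic function $f$ in $\Omega$ can be written $f=\overline g+h$ with $g,h$ analytic in $\Omega$; its (second complex) dilatation is $\omega=g'/h'=\overline{f_{\bar z}}/f_z$, with values in $\mathbb C\cup\{\infty\}$ ($\omega=\infty$ where $f_z=0$). If $f$ is locally univalent (that is, locally injective), its Jacobian $J_f=|f_z|^2-|f_{\bar z}|^2$ does not vanish, and its harmonic Schwarzian derivative is $$S_H(f)=\frac{\partial}{\partial z}P_H(f)-\tfrac12\,P_H(f)^2,\qquad P_H(f)=\frac{\partial}{\partial z}\log|J_f|.$$ An affine transformation of $f$ is a map $A\circ f=a\overline f+bf+c$ with $a,b,c\in\mathbb C$, $|a|\ne|b|$. An anti-analytic rotation of $f$ is a map $\mu\overline g+h$, where $f=\overline g+h$ with $g,h$ analytic in $\Omega$ and $|\mu|=1$. Let $f$ be a locally univalent harmonic mapping in $\Omega$. (0) Every affine transformation $F$ of $f$ and every anti-analytic rotation $F$ of $f$ is a locally univalent harmonic mapping in $\Omega$ with $S_H(F)=S_H(f)$. (i) Suppose that the dilatation of $f$ is not constant. Then a function $F$ on $\Omega$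 is a locally univalent harmonic mapping with $S_H(F)=S_H(f)$ if and only if $F$ is an affine transformation of an anti-analytic rotation of $f$. (ii) Suppose that the dilatation of $f$ is constant. Then there is an analytic function $h$ in $\Omega$ such that $$f=\alpha\overline h+h+\gamma\ \text{ for some }\alpha,\gamma\in\mathbb C,\ |\alpha|\ne1,\qquad\text{or}\qquad f=\overline h$$ (the second alternative covers the anti-analytic maps). For every such $h$, a function $F$ on $\Omega$ is a locally univalent harmonic mapping with $S_H(F)=S_H(f)$ if and only if there is a non-constant Möbius transformation $T(z)=\frac{az+b}{cz+d}$, $ad-bc\ne0$, without pole on $h(\Omega)$, such that $$F=\beta\,\overline{T\circ h}+T\circ h+\lambda\ \text{ for some }\beta,\lambda\in\mathbb C,\ |\beta|\ne1,\qquad\text{or}\qquad F=\overline{T\circ h}.$$ -/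

import Mathlib

open scoped Topology ComplexConjugate

namespace HarmonicMapping

noncomputable section

/-- The Wirtinger derivative `∂f/∂z = (f_x - i f_y) / 2`. -/
def dz (f : ℂ → ℂ) (z : ℂ) : ℂ :=
  (fderiv ℝ f z 1 - Complex.I * fderiv ℝ f z Complex.I) / 2

/-- The Wirtinger derivative `∂f/∂z̄ = (f_x + i f_y) / 2`. -/
def dzbar (f : ℂ → ℂ) (z : ℂ) : ℂ :=
  (fderiv ℝ f z 1 + Complex.I * fderiv ℝ f z Complex.I) / 2

/-- The Jacobian `J_f = |f_z|² - |f_z̄|²`. -/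
def jacobian (f : ℂ → ℂ) (z : ℂ) : ℝ :=
  ‖dz f z‖ ^ 2 - ‖dzbar f z‖ ^ 2

/-- The harmonic pre-Schwarzian derivative `P_H(f) = ∂/∂z (log |J_f|)`; the absolute value
matters only for orientation-reversing maps, for which `J_f < 0`. -/
def preSchwarzian (f : ℂ → ℂ) : ℂ → ℂ :=
  dz fun w => ((Real.log |jacobian f w| : ℝ) : ℂ)

/-- The harmonic Schwarzian derivative `S_H(f) = ∂/∂z (P_H(f)) - (P_H(f))² / 2`. -/
def schwarzian (f : ℂ → ℂ) (z : ℂ) : ℂ :=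
  dz (preSchwarzian f) z - (preSchwarzian f z) ^ 2 / 2

/-- `f` is a locally univalent (that is, locally injective) harmonic mapping in the open
set `Ω`. -/
def IsLocallyUnivalentHarmonic (Ω : Set ℂ) (f : ℂ → ℂ) : Prop :=
  InnerProductSpace.HarmonicOnNhd f Ω ∧ ∀ z ∈ Ω, ∃ U ∈ 𝓝 z, Set.InjOn f U

open Classical in
/-- The second complex dilatation `ω = conj (f_z̄) / f_z`, with values in the Riemann sphere.
For `f = conj g + h` with `g`, `h` analytic this is `g' / h'`. The value is `∞` where `f_z = 0`
(for a locally univalent map then `f_z̄ ≠ 0`). -/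
def dilatation (f : ℂ → ℂ) (z : ℂ) : OnePoint ℂ :=
  if dz f z = 0 then OnePoint.infty else ((conj (dzbar f z) / dz f z : ℂ) : OnePoint ℂ)

def HasConstantDilatation (Ω : Set ℂ) (f : ℂ → ℂ) : Prop :=
  ∃ c : OnePoint ℂ, ∀ z ∈ Ω, dilatation f z = c

/-- `F = A ∘ f` on `Ω` for a locally univalent affine harmonic mapping
`A(ζ) = a conj ζ + b ζ + c`, `|a| ≠ |b|`. -/
def IsAffinePostcomp (Ω : Set ℂ) (f F : ℂ → ℂ) : Prop :=
  ∃ a b c : ℂ, ‖a‖ ≠ ‖b‖ ∧ ∀ z ∈ Ω, F z = a * conj (f z) + b * f z + c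

/-- `F` is an anti-analytic rotation of `f` on `Ω`: `f = conj g + h` with `g`, `h` analytic in `Ω`,
and `F = μ conj g + h` with `|μ| = 1`. -/
def IsAntiAnalyticRotation (Ω : Set ℂ) (f F : ℂ → ℂ) : Prop :=
  ∃ g h : ℂ → ℂ, DifferentiableOn ℂ g Ω ∧ DifferentiableOn ℂ h Ω ∧
    (∀ z ∈ Ω, f z = conj (g z) + h z) ∧
    ∃ μ : ℂ, ‖μ‖ = 1 ∧ ∀ z ∈ Ω, F z = μ * conj (g z) + h z

/-- `F = β conj k + k + γ` on `Ω` with `|β| ≠ 1`, or `F = conj k` on `Ω`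
(the anti-analytic case, corresponding to `β = ∞`). -/
def IsConstantDilatationMap (Ω : Set ℂ) (k F : ℂ → ℂ) : Prop :=
  (∃ β γ : ℂ, ‖β‖ ≠ 1 ∧ ∀ z ∈ Ω, F z = β * conj (k z) + k z + γ) ∨
    ∀ z ∈ Ω, F z = conj (k z)

/-- `k = T ∘ h` on `Ω` for a non-constant Möbius transformation `T` that is finite
on `h(Ω)`. -/
def IsMobiusPostcomp (Ω : Set ℂ) (h k : ℂ → ℂ) : Prop :=
  ∃ a b c d : ℂ, a * d - b * c ≠ 0 ∧
    ∀ z ∈ Ω, c * h z + d ≠ 0 ∧ k z = (a * h z + b) / (c * h z + d)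

end

end HarmonicMapping

/-! On a simply connected domain f = conj g + h with g, h analytic (`exists_decomposition`), and by
Lewy's theorem (`Decomposition.jacobian_ne_zero`) local univalence amounts to J_f ≠ 0. Affine
transformations and anti-analytic rotations multiply J_f by a nonzero constant, so log |J_f| changes
by a constant and S_H is preserved.

For the converse put p = h', q = g', and P = H', Q = G' for F = conj G + H. At z, S_H(f) is rational
in p, q, their first two derivatives, conj p and conj q. For a sense-preserving map the conjugated
values may be taken at an independent point w, and polarization (`eq_zero_of_polarization`) turns
S_H(F) = S_H(f) into a statement about analytic Schwarzians: that of h + t g equals that of H + T G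
at every z, whenever t = -conj (q/p)(w) and T = -conj (Q/P)(w).

If the dilatation of f is not constant, affine transformations make both dilatations vanish at a
point z₀ where that of f still has nonzero derivative. There the Schwarzian and its derivative are
polynomials of degree at most 2 and 3 in the parameter; elimination (`exists_mul_eq_zero_of_jets`)
together with the identity theorem gives Q/P = κ q/p, with |κ| = 1. Now P + T Q = m (p + t q) with m
= P/p, and comparing two values of t forces m' = 0 (`exists_eq_const_mul`). So P = c p and Q = κ c
q: F arises from f by a rotation and affine maps, and the affine maps can all be moved to the
outside (`IsAffinePostcomp.exists_rotation_comm`).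

If the dilatation is constant, f is an affine image of an analytic h and S_H(f) is the classical
Schwarzian of h. A map F with the same S_H also has constant dilatation, since otherwise the
previous case with F in the role of f would yield a contradiction. So F comes from an analytic k
with the Schwarzian of h, and the linear equation y'' + (S/2) y = 0 gives k = T ∘ h. -/

namespace HarmonicMapping

noncomputable section

open Set Filter Metric

/-! ### Primitives on simply connected domains and the decomposition f = conj g + h. -/

section

/-- The type `ℂ` with the discrete topology. -/
@[ext] structure DiscreteComplex where
  /-- The underlying complex number. -/
  val : ℂ

instance : TopologicalSpace DiscreteComplex := ⊥

instance : DiscreteTopology DiscreteComplex := ⟨rfl⟩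

/-- The fibre bundle with discrete fibre `ℂ` whose transition functions are translations by the
locally constant differences `φ i - φ j`. -/
def translationBundle {X : Type*} [TopologicalSpace X] (U : X → Set X) (φ : X → X → ℂ)
    (hU : ∀ x, IsOpen (U x)) (hxU : ∀ x, x ∈ U x)
    (hφ : ∀ i j, ∀ y ∈ U i ∩ U j, ∀ᶠ z in 𝓝 y, φ i z - φ j z = φ i y - φ j y) :
    FiberBundleCore X X DiscreteComplex where
  baseSet := U
  isOpen_baseSet := hU
  indexAt := id
  mem_baseSet_at := hxU
  coordChange i j z v := ⟨v.val + (φ i z - φ j z)⟩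
  coordChange_self i x _ v := by
    ext
    simp
  continuousOn_coordChange i j := by
    rintro ⟨y, v⟩ ⟨hy, -⟩
    refine ContinuousAt.continuousWithinAt ?_
    unfold ContinuousAt
    rw [nhds_discrete DiscreteComplex, tendsto_pure, nhds_prod_eq, nhds_discrete DiscreteComplex]
    filter_upwards [(hφ i j y hy).prod_mk (eventually_pure.2 (rfl : v = v))] with p hp
    ext
    simp only [hp.1, hp.2]
  coordChange_comp i j k x _ v := by
    ext
    ring

/-- On a simply connected space, local functions with locally constant differences can be
corrected by locally constant functions so as to fit together to a global one. -/
theorem exists_global_of_locally_constant_sub {X : Type*} [TopologicalSpace X]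
    [SimplyConnectedSpace X] [LocallyPathConnectedSpace X] (U : X → Set X) (φ : X → X → ℂ)
    (hU : ∀ x, IsOpen (U x)) (hxU : ∀ x, x ∈ U x)
    (hφ : ∀ i j, ∀ y ∈ U i ∩ U j, ∀ᶠ z in 𝓝 y, φ i z - φ j z = φ i y - φ j y) :
    ∃ s : X → ℂ, ∀ x, ∀ y ∈ U x, ∀ᶠ z in 𝓝 y, s z - φ x z = s y - φ x y := by
  let Z := translationBundle U φ hU hxU hφ
  -- The discrete fibre makes the bundle a covering, and simple connectivity lifts the identity to a
  -- global section σ.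
  have cov : IsCoveringMap Z.proj :=
    IsFiberBundle.isCoveringMap (F := DiscreteComplex) fun x => ⟨Z.localTriv x, hxU x⟩
  obtain ⟨x₀⟩ : Nonempty X := inferInstance
  obtain ⟨σ, ⟨-, hσ⟩, -⟩ := cov.existsUnique_continuousMap_lifts (ContinuousMap.id X) x₀
    (⟨x₀, (⟨0⟩ : DiscreteComplex)⟩ : Z.TotalSpace) rfl
  have hσ1 : ∀ z, (σ z).1 = z := fun z => congrFun hσ z
  let v : X → DiscreteComplex := fun z => (σ z).2
  -- In the chart x the section has coordinate s z - φ x z. This coordinate is continuous with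
  -- values in a discrete space, hence locally constant.
  refine ⟨fun z => (v z).val + φ z z, fun x y hy => ?_⟩
  have hval : ∀ z, ((Z.localTriv x) (σ z)).2.val = (v z).val + φ z z - φ x z := by
    intro z
    rw [FiberBundleCore.localTriv_apply]
    change (v z).val + (φ (σ z).1 (σ z).1 - φ x (σ z).1) = _
    rw [hσ1 z]
    ring
  have hcont : ContinuousAt (fun z => ((Z.localTriv x) (σ z)).2) y := by
    refine continuous_snd.continuousAt.comp (ContinuousAt.comp ?_ σ.continuous.continuousAt)
    refine (Z.localTriv x).continuousAt ?_
    rw [FiberBundleCore.mem_localTriv_source]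
    change (σ y).1 ∈ U x
    rwa [hσ1]
  unfold ContinuousAt at hcont
  rw [nhds_discrete DiscreteComplex, tendsto_pure] at hcont
  filter_upwards [hcont] with z hz
  have h2 := hval z
  rw [hz] at h2
  exact h2.symm.trans (hval y)

/-- Holomorphic functions on simply connected open sets have primitives. -/
theorem exists_primitive {Ω : Set ℂ} (hΩ : IsOpen Ω) (hsc : IsSimplyConnected Ω) {p : ℂ → ℂ}
    (hp : DifferentiableOn ℂ p Ω) : ∃ P : ℂ → ℂ, ∀ z ∈ Ω, HasDerivAt P (p z) z := by
  classical
  have := hsc.simplyConnectedSpace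
  have := hΩ.locallyPathConnectedSpace
  have hball : ∀ x : Ω, ∃ r > 0, ball (x : ℂ) r ⊆ Ω := fun x => isOpen_iff.1 hΩ x x.2
  choose r hr hrΩ using hball
  have hprim : ∀ x : Ω, ∃ F : ℂ → ℂ, ∀ z ∈ ball (x : ℂ) (r x), HasDerivAt F (p z) z := fun x =>
    (hp.mono (hrΩ x)).isExactOn_ball
  choose F hF using hprim
  obtain ⟨s, hs⟩ := exists_global_of_locally_constant_sub
    (fun x : Ω => {z : Ω | (z : ℂ) ∈ ball (x : ℂ) (r x)}) (fun x z => F x z)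
    (fun x => isOpen_ball.preimage continuous_subtype_val)
    (fun x => mem_ball_self (hr x)) (by
      rintro i j y ⟨hyi, hyj⟩
      have hopen : IsOpen (ball (i : ℂ) (r i) ∩ ball (j : ℂ) (r j)) := isOpen_ball.inter isOpen_ball
      have hconv : Convex ℝ (ball (i : ℂ) (r i) ∩ ball (j : ℂ) (r j)) :=
        (convex_ball _ _).inter (convex_ball _ _)
      have hmem : ∀ᶠ z : Ω in 𝓝 y, (z : ℂ) ∈ ball (i : ℂ) (r i) ∩ ball (j : ℂ) (r j) :=
        continuous_subtype_val.continuousAt.eventually (hopen.mem_nhds ⟨hyi, hyj⟩)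
      filter_upwards [hmem] with z hz
      have hd : ∀ w ∈ ball (i : ℂ) (r i) ∩ ball (j : ℂ) (r j),
          HasDerivAt (fun w => F i w - F j w) 0 w := fun w hw => by
        simpa using (hF i w hw.1).fun_sub (hF j w hw.2)
      refine hopen.is_const_of_deriv_eq_zero hconv.isPreconnected
        (fun w hw => (hd w hw).differentiableAt.differentiableWithinAt)
        (fun w hw => (hd w hw).deriv) hz ⟨hyi, hyj⟩)
  refine ⟨fun z => if hz : z ∈ Ω then s ⟨z, hz⟩ else 0, fun z hz => ?_⟩
  have h1 := hs ⟨z, hz⟩ ⟨z, hz⟩ (mem_ball_self (hr _))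
  rw [nhds_subtype_eq_comap, eventually_comap] at h1
  have h2 := (hF ⟨z, hz⟩ z (mem_ball_self (hr _))).add_const (s ⟨z, hz⟩ - F ⟨z, hz⟩ z)
  refine h2.congr_of_eventuallyEq ?_
  filter_upwards [h1, hΩ.mem_nhds hz] with w hw hwΩ
  have h3 := hw ⟨w, hwΩ⟩ rfl
  simp only [hwΩ, dif_pos]
  linear_combination h3

/-- A real harmonic function on a simply connected open set is the real part of a holomorphic
function. -/
theorem exists_re_eq_of_harmonic {Ω : Set ℂ} (hΩ : IsOpen Ω) (hsc : IsSimplyConnected Ω)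
    {u : ℂ → ℝ} (hu : InnerProductSpace.HarmonicOnNhd u Ω) :
    ∃ P : ℂ → ℂ, DifferentiableOn ℂ P Ω ∧ ∀ z ∈ Ω, (P z).re = u z := by
  obtain ⟨P, hP⟩ := exists_primitive hΩ hsc
    (p := fun z => fderiv ℝ u z 1 - Complex.I * fderiv ℝ u z Complex.I)
    (fun z hz =>
      (HarmonicAt.differentiableAt_complex_partial (hu z hz)).differentiableWithinAt)
  obtain ⟨z₀, hz₀⟩ := hsc.nonempty
  have hconn : IsPreconnected Ω := hsc.isPathConnected.isConnected.isPreconnected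
  have hd : ∀ z ∈ Ω, HasFDerivAt (fun w => (P w).re - u w) (0 : ℂ →L[ℝ] ℝ) z := by
    intro z hz
    have h1 := (Complex.reCLM.hasFDerivAt).comp z ((hP z hz).hasFDerivAt.restrictScalars ℝ)
    have h2 := ((hu z hz).1.differentiableAt two_ne_zero).hasFDerivAt
    refine (h1.sub h2).congr_fderiv ?_
    ext a
    have ha : a = a.re • (1 : ℂ) + a.im • Complex.I := by simp
    conv_lhs => rw [ha]
    simp only [map_add, map_smul]
    simp
  have hconst : ∀ z ∈ Ω, (P z).re - u z = (P z₀).re - u z₀ := by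
    intro z hz
    exact hΩ.is_const_of_fderiv_eq_zero hconn
      (fun w hw => (hd w hw).differentiableAt.differentiableWithinAt)
      (fun w hw => (hd w hw).fderiv) hz hz₀
  refine ⟨fun z => P z - (((P z₀).re - u z₀ : ℝ) : ℂ),
    fun z hz => ((hP z hz).differentiableAt.sub_const _).differentiableWithinAt, fun z hz => ?_⟩
  have := hconst z hz
  rw [Complex.sub_re, Complex.ofReal_re]
  linarith

/-- Canonical decomposition of a harmonic function on a simply connected open set. -/
theorem exists_decomposition {Ω : Set ℂ} (hΩ : IsOpen Ω) (hsc : IsSimplyConnected Ω)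
    {f : ℂ → ℂ} (hf : InnerProductSpace.HarmonicOnNhd f Ω) :
    ∃ g h : ℂ → ℂ, DifferentiableOn ℂ g Ω ∧ DifferentiableOn ℂ h Ω ∧
      ∀ z ∈ Ω, f z = conj (g z) + h z := by
  obtain ⟨P, hP, hPu⟩ := exists_re_eq_of_harmonic hΩ hsc (u := fun z => (f z).re)
    (fun z hz => (hf z hz).comp_CLM (l := Complex.reCLM))
  obtain ⟨Q, hQ, hQu⟩ := exists_re_eq_of_harmonic hΩ hsc (u := fun z => (f z).im)
    (fun z hz => (hf z hz).comp_CLM (l := Complex.imCLM))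
  -- Obtained by writing f = Re P + i Re Q with 2 Re P = P + conj P, and likewise for Q.
  refine ⟨fun z => (P z - Complex.I * Q z) / 2, fun z => (P z + Complex.I * Q z) / 2,
    by fun_prop, by fun_prop, fun z hz => ?_⟩
  apply Complex.ext
  · simp [← hPu z hz, map_ofNat]; ring
  · simp [← hQu z hz, map_ofNat]; ring

theorem harmonicOnNhd_of_decomposition {Ω : Set ℂ} (hΩ : IsOpen Ω) {f g h : ℂ → ℂ}
    (hg : DifferentiableOn ℂ g Ω) (hh : DifferentiableOn ℂ h Ω)
    (hf : ∀ z ∈ Ω, f z = conj (g z) + h z) : InnerProductSpace.HarmonicOnNhd f Ω := by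
  intro z hz
  have h1 : InnerProductSpace.HarmonicAt (conj g) z :=
    (hg.analyticAt (hΩ.mem_nhds hz)).harmonicAt_conj
  have h2 : InnerProductSpace.HarmonicAt h z := (hh.analyticAt (hΩ.mem_nhds hz)).harmonicAt
  refine (InnerProductSpace.harmonicAt_congr_nhds ?_).1 (h1.add h2)
  filter_upwards [hΩ.mem_nhds hz] with w hw
  simp [hf w hw]

end

/-! ### Wirtinger calculus and the formula for S_H in terms of g and h. -/

section

/-- The real-linear map `v ↦ a v + b conj v`. -/
def wirtingerCLM (a b : ℂ) : ℂ →L[ℝ] ℂ :=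
  a • ContinuousLinearMap.id ℝ ℂ + b • (Complex.conjCLE : ℂ →L[ℝ] ℂ)

@[simp]
theorem wirtingerCLM_apply (a b v : ℂ) : wirtingerCLM a b v = a * v + b * conj v := by
  simp [wirtingerCLM]

/-- `f` is real differentiable at `z` with `f_z = a` and `f_z̄ = b`. -/
def HasWirtingerAt (f : ℂ → ℂ) (a b z : ℂ) : Prop :=
  HasFDerivAt f (wirtingerCLM a b) z

namespace HasWirtingerAt

variable {f g : ℂ → ℂ} {a b c d z : ℂ}

theorem dz_eq (hf : HasWirtingerAt f a b z) : dz f z = a := by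
  rw [dz, hf.fderiv]
  simp
  linear_combination (-a / 2 + b / 2) * Complex.I_mul_I

theorem dzbar_eq (hf : HasWirtingerAt f a b z) : dzbar f z = b := by
  rw [dzbar, hf.fderiv]
  simp
  linear_combination (a / 2 - b / 2) * Complex.I_mul_I

theorem congr_of_eventuallyEq (hf : HasWirtingerAt f a b z) (h : g =ᶠ[𝓝 z] f) :
    HasWirtingerAt g a b z :=
  HasFDerivAt.congr_of_eventuallyEq hf h

theorem of_hasDerivAt (hf : HasDerivAt f a z) : HasWirtingerAt f a 0 z := by
  refine (hf.hasFDerivAt.restrictScalars ℝ).congr_fderiv ?_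
  ext v
  simp [mul_comm]

theorem add (hf : HasWirtingerAt f a b z) (hg : HasWirtingerAt g c d z) :
    HasWirtingerAt (fun w => f w + g w) (a + c) (b + d) z := by
  refine (HasFDerivAt.fun_add hf hg).congr_fderiv ?_
  ext v
  simp
  ring

theorem sub (hf : HasWirtingerAt f a b z) (hg : HasWirtingerAt g c d z) :
    HasWirtingerAt (fun w => f w - g w) (a - c) (b - d) z := by
  refine (HasFDerivAt.fun_sub hf hg).congr_fderiv ?_
  ext v
  simp
  ring

theorem mul (hf : HasWirtingerAt f a b z) (hg : HasWirtingerAt g c d z) :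
    HasWirtingerAt (fun w => f w * g w) (a * g z + f z * c) (b * g z + f z * d) z := by
  refine (HasFDerivAt.mul' hf hg).congr_fderiv ?_
  ext v
  simp
  ring

theorem comp_conj (hf : HasWirtingerAt f a b z) :
    HasWirtingerAt (fun w => conj (f w)) (conj b) (conj a) z := by
  refine ((Complex.conjCLE : ℂ →L[ℝ] ℂ).hasFDerivAt.comp z hf).congr_fderiv ?_
  ext v
  simp
  ring

theorem comp_hasDerivAt {φ : ℂ → ℂ} (hφ : HasDerivAt φ c (f z)) (hf : HasWirtingerAt f a b z) :
    HasWirtingerAt (fun w => φ (f w)) (c * a) (c * b) z := by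
  refine ((hφ.hasFDerivAt.restrictScalars ℝ).comp z hf).congr_fderiv ?_
  ext v
  simp
  ring

theorem div (hf : HasWirtingerAt f a b z) (hg : HasWirtingerAt g c d z) (h0 : g z ≠ 0) :
    HasWirtingerAt (fun w => f w / g w) ((a * g z - f z * c) / g z ^ 2)
      ((b * g z - f z * d) / g z ^ 2) z := by
  have h := hf.mul (comp_hasDerivAt (hasDerivAt_inv h0) hg)
  simp only [← div_eq_mul_inv] at h
  convert! h using 1 <;> field_simp <;> ring

theorem log_abs {J : ℂ → ℝ} (hJ : HasWirtingerAt (fun w => (J w : ℂ)) a b z) (h0 : J z ≠ 0) :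
    HasWirtingerAt (fun w => ((Real.log |J w| : ℝ) : ℂ)) (a / J z) (b / J z) z := by
  have h1 : HasFDerivAt J (Complex.reCLM.comp (wirtingerCLM a b)) z :=
    (Complex.reCLM.hasFDerivAt).comp z hJ
  have h2 := (Complex.ofRealCLM.hasFDerivAt).comp z h1
  -- J is real, so its derivative `wirtingerCLM a b` takes real values; this lets the real chain
  -- rule for the logarithm be read as a complex one.
  have h3 := HasFDerivAt.unique hJ h2
  have h4 := (Complex.ofRealCLM.hasFDerivAt).comp z (h1.log h0)
  simp only [Real.log_abs]
  refine h4.congr_fderiv ?_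
  ext v
  have h5 := congrArg (fun L => L v) h3
  simp only [wirtingerCLM_apply, ContinuousLinearMap.comp_apply, Complex.ofRealCLM_apply,
    Complex.reCLM_apply, smul_apply, smul_eq_mul, Complex.ofReal_mul,
    Complex.ofReal_inv] at h5 ⊢
  rw [← h5]
  field_simp

end HasWirtingerAt

theorem dz_congr {f g : ℂ → ℂ} {z : ℂ} (h : f =ᶠ[𝓝 z] g) : dz f z = dz g z := by
  rw [dz, dz, h.fderiv_eq]

/-- `f = conj g + h` on the open set `Ω` with `g`, `h` holomorphic. -/
structure Decomposition (Ω : Set ℂ) (f g h : ℂ → ℂ) : Prop where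
  isOpen : IsOpen Ω
  left : DifferentiableOn ℂ g Ω
  right : DifferentiableOn ℂ h Ω
  eq : ∀ z ∈ Ω, f z = conj (g z) + h z

namespace Decomposition

variable {Ω : Set ℂ} {f g h : ℂ → ℂ} {z : ℂ}

theorem hasWirtingerAt (D : Decomposition Ω f g h) (hz : z ∈ Ω) :
    HasWirtingerAt f (deriv h z) (conj (deriv g z)) z := by
  have hn := D.isOpen.mem_nhds hz
  have h1 := ((HasWirtingerAt.of_hasDerivAt (D.left.differentiableAt hn).hasDerivAt).comp_conj).add
    (HasWirtingerAt.of_hasDerivAt (D.right.differentiableAt hn).hasDerivAt)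
  simp only [map_zero, zero_add, add_zero] at h1
  exact h1.congr_of_eventuallyEq (by filter_upwards [hn] with w hw using D.eq w hw)

theorem dz_eq (D : Decomposition Ω f g h) (hz : z ∈ Ω) : dz f z = deriv h z :=
  (D.hasWirtingerAt hz).dz_eq

theorem dzbar_eq (D : Decomposition Ω f g h) (hz : z ∈ Ω) : dzbar f z = conj (deriv g z) :=
  (D.hasWirtingerAt hz).dzbar_eq

theorem jacobian_eq (D : Decomposition Ω f g h) (hz : z ∈ Ω) :
    jacobian f z = ‖deriv h z‖ ^ 2 - ‖deriv g z‖ ^ 2 := by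
  rw [jacobian, D.dz_eq hz, D.dzbar_eq hz, RCLike.norm_conj]

theorem ofReal_jacobian_eq (D : Decomposition Ω f g h) (hz : z ∈ Ω) :
    (jacobian f z : ℂ) = deriv h z * conj (deriv h z) - deriv g z * conj (deriv g z) := by
  rw [D.jacobian_eq hz, Complex.mul_conj', Complex.mul_conj']
  push_cast
  ring

theorem harmonicOnNhd (D : Decomposition Ω f g h) : InnerProductSpace.HarmonicOnNhd f Ω :=
  harmonicOnNhd_of_decomposition D.isOpen D.left D.right D.eq

end Decomposition

/-- The expression `N₂ / N₀ - (3/2) (N₁ / N₀)²` with `Nₖ = p⁽ᵏ⁾ a - q⁽ᵏ⁾ b`, which for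
`p = h'`, `q = g'`, `a = conj (p z)`, `b = conj (q z)` is the harmonic Schwarzian derivative
of `conj g + h`. -/
def schwarzianKernel (p q : ℂ → ℂ) (z a b : ℂ) : ℂ :=
  (deriv (deriv p) z * a - deriv (deriv q) z * b) / (p z * a - q z * b) -
    3 / 2 * ((deriv p z * a - deriv q z * b) / (p z * a - q z * b)) ^ 2

/-- ∂/∂z does not see conj p and conj q, so it sends N₀ = J_f to N₁ and N₁ to N₂. Thus P_H = N₁/N₀,
and ∂P_H/∂z contributes a further -(N₁/N₀)² to the term -(N₁/N₀)²/2. -/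
theorem Decomposition.schwarzian_eq {Ω : Set ℂ} {f g h : ℂ → ℂ} (D : Decomposition Ω f g h)
    (hJ : ∀ z ∈ Ω, jacobian f z ≠ 0) {z : ℂ} (hz : z ∈ Ω) :
    schwarzian f z = schwarzianKernel (deriv h) (deriv g) z (conj (deriv h z))
      (conj (deriv g z)) := by
  have hp := D.right.deriv D.isOpen
  have hq := D.left.deriv D.isOpen
  have hp' := hp.deriv D.isOpen
  have hq' := hq.deriv D.isOpen
  set p := deriv h
  set q := deriv g
  have W : ∀ {r : ℂ → ℂ}, DifferentiableOn ℂ r Ω → ∀ {w}, w ∈ Ω →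
      HasWirtingerAt r (deriv r w) 0 w := fun hr w hw =>
    HasWirtingerAt.of_hasDerivAt (hr.differentiableAt (D.isOpen.mem_nhds hw)).hasDerivAt
  have hJw : ∀ w ∈ Ω, HasWirtingerAt (fun w => (jacobian f w : ℂ))
      (deriv p w * conj (p w) - deriv q w * conj (q w))
      (p w * conj (deriv p w) - q w * conj (deriv q w)) w := by
    intro w hw
    have h1 := ((W hp hw).mul (W hp hw).comp_conj).sub ((W hq hw).mul (W hq hw).comp_conj)
    simp only [map_zero, mul_zero, zero_mul, zero_add, add_zero] at h1
    refine h1.congr_of_eventuallyEq ?_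
    filter_upwards [D.isOpen.mem_nhds hw] with v hv using D.ofReal_jacobian_eq hv
  have hP : ∀ w ∈ Ω, preSchwarzian f w =
      (deriv p w * conj (p w) - deriv q w * conj (q w)) / (jacobian f w : ℂ) := fun w hw =>
    ((hJw w hw).log_abs (hJ w hw)).dz_eq
  have h0 : (jacobian f z : ℂ) ≠ 0 := Complex.ofReal_ne_zero.2 (hJ z hz)
  have hN := ((W hp' hz).mul (W hp hz).comp_conj).sub ((W hq' hz).mul (W hq hz).comp_conj)
  have h2 := ((hN.div (hJw z hz) h0).congr_of_eventuallyEq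
    (by filter_upwards [D.isOpen.mem_nhds hz] with w hw using hP w hw)).dz_eq
  rw [schwarzian, h2, hP z hz, schwarzianKernel, ← D.ofReal_jacobian_eq hz]
  simp only [map_zero, mul_zero, add_zero]
  field_simp
  ring

end

/-! ### Lewy's theorem: local univalence is the nonvanishing of the Jacobian. -/

section

/-- Two continuous real functions on `[0, δ]` with the same initial value that end above it
have a common value that is attained after time `0`. -/
theorem exists_common_value {v w : ℝ → ℝ} {δ c : ℝ} (hδ : 0 ≤ δ) (hv : ContinuousOn v (Icc 0 δ))
    (hw : ContinuousOn w (Icc 0 δ)) (hv0 : v 0 = c) (hw0 : w 0 = c) (hvδ : c < v δ)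
    (hwδ : c < w δ) : ∃ s ∈ Ioc 0 δ, ∃ t ∈ Ioc 0 δ, v s = w t := by
  set m := min (v δ) (w δ)
  have hm : c < m := lt_min hvδ hwδ
  obtain ⟨s, hs, hsm⟩ := intermediate_value_Ioc hδ hv
    (⟨by rw [hv0]; exact hm, min_le_left _ _⟩ : m ∈ Ioc (v 0) (v δ))
  obtain ⟨t, ht, htm⟩ := intermediate_value_Ioc hδ hw
    (⟨by rw [hw0]; exact hm, min_le_right _ _⟩ : m ∈ Ioc (w 0) (w δ))
  exact ⟨s, hs, t, ht, hsm.trans htm.symm⟩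

/-- A star with three legs does not embed in the real line. -/
theorem exists_common_value_of_three {v : Fin 3 → ℝ → ℝ} {δ c : ℝ} (hδ : 0 ≤ δ)
    (hv : ∀ i, ContinuousOn (v i) (Icc 0 δ)) (hv0 : ∀ i, v i 0 = c) (hvδ : ∀ i, v i δ ≠ c) :
    ∃ i j, i ≠ j ∧ ∃ s ∈ Ioc 0 δ, ∃ t ∈ Ioc 0 δ, v i s = v j t := by
  have up : ∀ i j, i ≠ j → c < v i δ → c < v j δ →
      ∃ i j, i ≠ j ∧ ∃ s ∈ Ioc 0 δ, ∃ t ∈ Ioc 0 δ, v i s = v j t := fun i j hij hi hj =>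
    ⟨i, j, hij, exists_common_value hδ (hv i) (hv j) (hv0 i) (hv0 j) hi hj⟩
  have down : ∀ i j, i ≠ j → v i δ < c → v j δ < c →
      ∃ i j, i ≠ j ∧ ∃ s ∈ Ioc 0 δ, ∃ t ∈ Ioc 0 δ, v i s = v j t := fun i j hij hi hj => by
    obtain ⟨s, hs, t, ht, h⟩ := exists_common_value (c := -c) hδ (hv i).neg (hv j).neg
      (by simp [hv0]) (by simp [hv0]) (by simpa using hi) (by simpa using hj)
    exact ⟨i, j, hij, s, hs, t, ht, by simpa using h⟩
  -- Two of the three end values lie on the same side of c.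
  rcases (hvδ 0).lt_or_gt with h0 | h0 <;> rcases (hvδ 1).lt_or_gt with h1 | h1 <;>
    rcases (hvδ 2).lt_or_gt with h2 | h2
  · exact down 0 1 (by decide) h0 h1
  · exact down 0 1 (by decide) h0 h1
  · exact down 0 2 (by decide) h0 h2
  · exact up 1 2 (by decide) h1 h2
  · exact down 1 2 (by decide) h1 h2
  · exact up 0 2 (by decide) h0 h2
  · exact up 0 1 (by decide) h0 h1
  · exact up 0 1 (by decide) h0 h1

/-- An injective continuous map cannot send three arcs emanating from a point into a line. -/
theorem not_injOn_of_three_arcs {f ψ : ℂ → ℂ} {U : Set ℂ} {e : ℂ} {c ρ : ℝ} {ζ : Fin 3 → ℂ}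
    (hρ : 0 < ρ) (he : e ≠ 0) (hf : ContinuousOn f U) (hinj : InjOn f U)
    (hψ : ContinuousOn ψ (closedBall 0 ρ)) (hψinj : InjOn ψ (closedBall 0 ρ))
    (hψU : MapsTo ψ (closedBall 0 ρ) U) (hζ : ∀ i, ‖ζ i‖ = 1) (hζinj : Function.Injective ζ)
    (hre : ∀ i, ∀ t ∈ Icc 0 ρ, (e * f (ψ (t * ζ i))).re = c) : False := by
  have hball : ∀ i, ∀ t ∈ Icc 0 ρ, (t * ζ i : ℂ) ∈ closedBall (0 : ℂ) ρ := fun i t ht => by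
    simp [hζ, abs_of_nonneg ht.1, ht.2]
  -- Re (e f) is the same constant on all the arcs, so there Im (e f) alone separates points.
  have key : ∀ i j, ∀ s ∈ Icc 0 ρ, ∀ t ∈ Icc 0 ρ,
      (e * f (ψ (s * ζ i))).im = (e * f (ψ (t * ζ j))).im → (s * ζ i : ℂ) = t * ζ j := by
    intro i j s hs t ht h
    have h1 : e * f (ψ (s * ζ i)) = e * f (ψ (t * ζ j)) :=
      Complex.ext ((hre i s hs).trans (hre j t ht).symm) h
    exact hψinj (hball i s hs) (hball j t ht)
      (hinj (hψU (hball i s hs)) (hψU (hball j t ht)) (mul_left_cancel₀ he h1))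
  have h0 : (0 : ℝ) ∈ Icc 0 ρ := ⟨le_rfl, hρ.le⟩
  have hρ' : ρ ∈ Icc 0 ρ := ⟨hρ.le, le_rfl⟩
  obtain ⟨i, j, hij, s, hs, t, ht, hst⟩ := exists_common_value_of_three
    (v := fun i t => (e * f (ψ (t * ζ i))).im) (c := (e * f (ψ 0)).im) hρ.le
    (fun i => by
      refine Complex.continuous_im.comp_continuousOn (continuousOn_const.mul ?_)
      refine hf.comp (hψ.comp (by fun_prop) (fun t ht => hball i t ht)) ?_
      exact fun t ht => hψU (hball i t ht))
    (fun i => by simp)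
    (fun i h => by
      have := key i i ρ hρ' 0 h0 (by simpa using h)
      have h2 := congrArg norm this
      simp [hζ] at h2
      exact hρ.ne' h2)
  have h1 := key i j s ⟨hs.1.le, hs.2⟩ t ⟨ht.1.le, ht.2⟩ hst
  have h2 := congrArg norm h1
  simp only [norm_mul, hζ, mul_one, Complex.norm_real, Real.norm_eq_abs, abs_of_pos hs.1,
    abs_of_pos ht.1] at h2
  rw [h2] at h1
  exact hij (hζinj (mul_left_cancel₀ (Complex.ofReal_ne_zero.2 ht.1.ne') h1))

/-- For `n ≥ 2` there are three different `ζ` of modulus one with `ζⁿ` purely imaginary. -/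
theorem exists_three_pow_re_eq_zero {n : ℕ} (hn : 2 ≤ n) :
    ∃ ζ : Fin 3 → ℂ, Function.Injective ζ ∧ ∀ i, ‖ζ i‖ = 1 ∧ (ζ i ^ n).re = 0 := by
  have hn0 : 0 < n := by omega
  obtain ⟨a, ha⟩ := IsAlgClosed.exists_pow_nat_eq Complex.I hn0
  obtain ⟨b, hb⟩ := IsAlgClosed.exists_pow_nat_eq (-Complex.I) hn0
  obtain ⟨ω, hω⟩ : ∃ ω : ℂ, IsPrimitiveRoot ω n := ⟨_, Complex.isPrimitiveRoot_exp n hn0.ne'⟩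
  have hω1 : ω ≠ 1 := hω.ne_one (by omega)
  have hII : Complex.I ≠ -Complex.I := fun h => by
    have := congrArg Complex.im h
    norm_num at this
  have hnorm : ∀ z : ℂ, ‖z ^ n‖ = 1 → ‖z‖ = 1 := fun z h => by
    rw [norm_pow] at h
    exact (pow_eq_one_iff_of_nonneg (norm_nonneg z) hn0.ne').1 h
  have ha0 : a ≠ 0 := by rintro rfl; simp [hn0.ne', Complex.I_ne_zero.symm] at ha
  have haω : (a * ω) ^ n = Complex.I := by rw [mul_pow, hω.pow_eq_one, mul_one, ha]
  have hab : a ≠ b := by rintro rfl; exact hII (ha.symm.trans hb)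
  have haωb : a * ω ≠ b := by rintro h; rw [h] at haω; exact hII (haω.symm.trans hb)
  have haaω : a ≠ a * ω := fun h => hω1 (mul_left_cancel₀ ha0 (by rw [← h, mul_one]))
  refine ⟨![a, b, a * ω], ?_, ?_⟩
  · intro i j h
    fin_cases i <;> fin_cases j <;> simp_all
  · intro i
    fin_cases i
    · exact ⟨hnorm a (by simp [ha]), by simp [ha]⟩
    · exact ⟨hnorm b (by simp [hb]), by simp [hb]⟩
    · exact ⟨hnorm (a * ω) (by simp [haω]),
        by simp only [Fin.reduceFinMk, Matrix.cons_val, haω, Complex.I_re]⟩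

/-- Analytic functions that do not vanish have local analytic `n`th roots. -/
theorem exists_local_root {r : ℂ → ℂ} {z₀ : ℂ} (hr : AnalyticAt ℂ r z₀) (h0 : r z₀ ≠ 0) {n : ℕ}
    (hn : n ≠ 0) : ∃ s : ℂ → ℂ, AnalyticAt ℂ s z₀ ∧ s z₀ ≠ 0 ∧ ∀ᶠ z in 𝓝 z₀, s z ^ n = r z := by
  obtain ⟨a, ha⟩ := IsAlgClosed.exists_pow_nat_eq (r z₀) (Nat.pos_of_ne_zero hn)
  have ha0 : a ≠ 0 := by rintro rfl; simp [hn] at ha; exact h0 ha.symm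
  have hq : AnalyticAt ℂ (fun z => r z / r z₀) z₀ := hr.div analyticAt_const h0
  have h1 : r z₀ / r z₀ ∈ Complex.slitPlane := by rw [div_self h0]; exact Complex.one_mem_slitPlane
  refine ⟨fun z => a * Complex.exp (Complex.log (r z / r z₀) / n), ?_, ?_, ?_⟩
  · exact analyticAt_const.mul ((hq.clog h1).div analyticAt_const (Nat.cast_ne_zero.2 hn)).cexp
  · simp [ha0]
  · filter_upwards [hq.continuousAt.eventually_ne (div_ne_zero h0 h0)] with z hz
    rw [mul_pow, ha, ← Complex.exp_nat_mul, mul_div_cancel₀ _ (Nat.cast_ne_zero.2 hn),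
      Complex.exp_log hz, mul_div_cancel₀ _ h0]

/-- At a critical point of a holomorphic function `k` there is a local homeomorphism `ψ` and there
are three directions along which `Re k ∘ ψ` is constant. -/
theorem exists_arcs_re_eq {k : ℂ → ℂ} {z₀ : ℂ} (hk : AnalyticAt ℂ k z₀) (hk' : deriv k z₀ = 0)
    {V : Set ℂ} (hV : V ∈ 𝓝 z₀) :
    ∃ (ψ : ℂ → ℂ) (ρ : ℝ) (ζ : Fin 3 → ℂ), 0 < ρ ∧ ContinuousOn ψ (closedBall 0 ρ) ∧
      InjOn ψ (closedBall 0 ρ) ∧ MapsTo ψ (closedBall 0 ρ) V ∧ (∀ i, ‖ζ i‖ = 1) ∧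
      Function.Injective ζ ∧ ∀ i, ∀ t ∈ Icc 0 ρ, (k (ψ (t * ζ i))).re = (k z₀).re := by
  -- Normal form k = k z₀ + φⁿ in a local coordinate φ, with ψ the inverse of φ: on a ray t ζ with
  -- ζⁿ imaginary, the real part of k does not change.
  suffices h : ∃ (n : ℕ) (φ : ℂ → ℂ), 2 ≤ n ∧ AnalyticAt ℂ φ z₀ ∧ φ z₀ = 0 ∧ deriv φ z₀ ≠ 0 ∧
      ((∀ᶠ z in 𝓝 z₀, k z = k z₀ + φ z ^ n) ∨ ∀ᶠ z in 𝓝 z₀, k z = k z₀) by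
    obtain ⟨n, φ, hn, hφ, hφ0, hφ', hcase⟩ := h
    have hs : HasStrictDerivAt φ (deriv φ z₀) z₀ := hφ.hasStrictDerivAt
    let e := (hs.hasStrictFDerivAt_equiv hφ').toOpenPartialHomeomorph φ
    have hz₀ : z₀ ∈ e.source :=
      (hs.hasStrictFDerivAt_equiv hφ').mem_toOpenPartialHomeomorph_source
    have he : ∀ z, e z = φ z := fun z => rfl
    have h0t : (0 : ℂ) ∈ e.target := by rw [← hφ0, ← he]; exact e.map_source hz₀
    have hsymm0 : e.symm 0 = z₀ := by rw [← hφ0, ← he]; exact e.left_inv hz₀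
    obtain ⟨ζ, hζinj, hζ⟩ := exists_three_pow_re_eq_zero hn
    have hcase' : ∀ᶠ z in 𝓝 z₀, k z = k z₀ + φ z ^ n ∨ k z = k z₀ := by
      rcases hcase with h | h
      · filter_upwards [h] with z hz using Or.inl hz
      · filter_upwards [h] with z hz using Or.inr hz
    have hcont : Tendsto e.symm (𝓝 0) (𝓝 z₀) := by
      have := e.continuousAt_symm h0t
      rwa [ContinuousAt, hsymm0] at this
    obtain ⟨ρ, hρ, hsub⟩ := nhds_basis_closedBall.mem_iff.1
      (inter_mem (e.open_target.mem_nhds h0t) (hcont.eventually (hcase'.and hV)))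
    refine ⟨e.symm, ρ, ζ, hρ, e.continuousOn_symm.mono fun z hz => (hsub hz).1,
      e.symm.injOn.mono fun z hz => (hsub hz).1, fun z hz => (hsub hz).2.2,
      fun i => (hζ i).1, hζinj, fun i t ht => ?_⟩
    have hb : (t * ζ i : ℂ) ∈ closedBall (0 : ℂ) ρ := by
      simp [(hζ i).1, abs_of_nonneg ht.1, ht.2]
    rcases (hsub hb).2.1 with h | h
    · rw [h, ← he, e.right_inv (hsub hb).1, mul_pow, Complex.add_re, ← Complex.ofReal_pow,
        Complex.re_ofReal_mul, (hζ i).2, mul_zero, add_zero]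
    · rw [h]
  have hk0 : AnalyticAt ℂ (fun z => k z - k z₀) z₀ := hk.sub analyticAt_const
  by_cases hconst : ∀ᶠ z in 𝓝 z₀, k z - k z₀ = 0
  -- If k is locally constant, any coordinate and any exponent n ≥ 2 will do.
  · refine ⟨2, fun z => z - z₀, le_rfl, by fun_prop, by simp, by simp, Or.inr ?_⟩
    filter_upwards [hconst] with z hz using sub_eq_zero.1 hz
  · obtain ⟨n, r, hr, hr0, hev⟩ := hk0.exists_eventuallyEq_pow_smul_nonzero_iff.2 hconst
    simp only [smul_eq_mul] at hev
    have hn0 : n ≠ 0 := by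
      rintro rfl
      have := hev.self_of_nhds
      simp at this
      exact hr0 this.symm
    have hn1 : n ≠ 1 := by
      rintro rfl
      have h1 : HasDerivAt (fun z => (z - z₀) ^ 1 * r z) (r z₀) z₀ := by
        have := ((hasDerivAt_id z₀).sub_const z₀).fun_mul hr.differentiableAt.hasDerivAt
        simpa using this
      have h2 : HasDerivAt (fun z => k z - k z₀) (r z₀) z₀ := h1.congr_of_eventuallyEq hev
      have h3 := (hk.differentiableAt.hasDerivAt.sub_const (k z₀)).unique h2
      exact hr0 (h3.symm.trans hk')
    obtain ⟨s, hs, hs0, hsr⟩ := exists_local_root hr hr0 hn0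
    have hφ : HasDerivAt (fun z => (z - z₀) * s z) (s z₀) z₀ := by
      have := ((hasDerivAt_id z₀).sub_const z₀).fun_mul hs.differentiableAt.hasDerivAt
      simpa using this
    refine ⟨n, fun z => (z - z₀) * s z, by omega, by fun_prop, by simp, by rwa [hφ.deriv],
      Or.inl ?_⟩
    filter_upwards [hev, hsr] with z hz hz'
    rw [mul_pow, hz']
    linear_combination hz

/-- Lewy's theorem: the Jacobian of a locally injective harmonic map does not vanish. -/
theorem Decomposition.jacobian_ne_zero {Ω : Set ℂ} {f g h : ℂ → ℂ} (D : Decomposition Ω f g h)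
    {z₀ : ℂ} (hz₀ : z₀ ∈ Ω) {U : Set ℂ} (hU : U ∈ 𝓝 z₀) (hinj : InjOn f U) :
    jacobian f z₀ ≠ 0 := by
  intro hJ
  rw [D.jacobian_eq hz₀, sub_eq_zero, sq_eq_sq₀ (norm_nonneg _) (norm_nonneg _)] at hJ
  have hn := D.isOpen.mem_nhds hz₀
  -- Re (e f) is the real part of the analytic function e h + conj e · g. The direction e is chosen
  -- to make z₀ critical for it, which is possible because |g'| = |h'| at z₀: take e² = -g'/h'.
  obtain ⟨e, he, he'⟩ : ∃ e : ℂ, ‖e‖ = 1 ∧ e * deriv h z₀ + conj e * deriv g z₀ = 0 := by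
    by_cases h0 : deriv h z₀ = 0
    · have hg0 : deriv g z₀ = 0 := by rw [← norm_eq_zero, ← hJ, h0, norm_zero]
      exact ⟨1, by simp, by simp [h0, hg0]⟩
    · obtain ⟨e, he⟩ := IsAlgClosed.exists_pow_nat_eq (-(deriv g z₀ / deriv h z₀)) two_pos
      have hen : ‖e‖ = 1 := by
        have := congrArg norm he
        rw [norm_pow, norm_neg, norm_div, hJ, div_self (hJ ▸ norm_ne_zero_iff.2 h0)] at this
        exact (pow_eq_one_iff_of_nonneg (norm_nonneg e) two_ne_zero).1 this
      refine ⟨e, hen, ?_⟩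
      have hec : e * conj e = 1 := by simp [Complex.mul_conj', hen]
      have hg : deriv g z₀ = -(e ^ 2) * deriv h z₀ := by rw [he]; field_simp
      rw [hg]
      linear_combination (-e * deriv h z₀) * hec
  have he0 : e ≠ 0 := by rintro rfl; simp at he
  have hh := D.right.analyticAt hn
  have hg := D.left.analyticAt hn
  have hk : AnalyticAt ℂ (fun z => e * h z + conj e * g z) z₀ := by fun_prop
  have hk' : deriv (fun z => e * h z + conj e * g z) z₀ = 0 := by
    rw [← he']
    exact ((hh.differentiableAt.hasDerivAt.const_mul e).add
      (hg.differentiableAt.hasDerivAt.const_mul (conj e))).deriv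
  obtain ⟨ψ, ρ, ζ, hρ, hψ, hψinj, hψV, hζ, hζinj, hre⟩ :=
    exists_arcs_re_eq hk hk' (inter_mem hU hn)
  refine not_injOn_of_three_arcs (U := U ∩ Ω) (c := (e * h z₀ + conj e * g z₀).re) hρ he0
    ?_ (hinj.mono inter_subset_left) hψ hψinj hψV hζ hζinj fun i t ht => ?_
  · exact D.harmonicOnNhd.continuousOn.mono inter_subset_right
  · rw [← hre i t ht]
    have hb : (t * ζ i : ℂ) ∈ closedBall (0 : ℂ) ρ := by simp [hζ, abs_of_nonneg ht.1, ht.2]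
    rw [D.eq _ (hψV hb).2]
    simp [Complex.mul_re]
    ring

theorem wirtingerCLM_injective {a b : ℂ} (h : ‖a‖ ≠ ‖b‖) :
    Function.Injective (wirtingerCLM a b) := by
  rw [injective_iff_map_eq_zero]
  intro v hv
  by_contra hv0
  rw [wirtingerCLM_apply, add_eq_zero_iff_eq_neg] at hv
  have h1 := congrArg norm hv
  rw [norm_neg, norm_mul, norm_mul, RCLike.norm_conj] at h1
  exact h (mul_right_cancel₀ (norm_ne_zero_iff.2 hv0) h1)

theorem Decomposition.exists_injOn {Ω : Set ℂ} {f g h : ℂ → ℂ} (D : Decomposition Ω f g h)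
    {z : ℂ} (hz : z ∈ Ω) (hJ : jacobian f z ≠ 0) : ∃ U ∈ 𝓝 z, InjOn f U := by
  have hab : ‖deriv h z‖ ≠ ‖conj (deriv g z)‖ := by
    rw [RCLike.norm_conj]
    intro h
    rw [D.jacobian_eq hz, h, sub_self] at hJ
    exact hJ rfl
  let L : ℂ ≃L[ℝ] ℂ := (LinearEquiv.ofInjectiveEndo
    (wirtingerCLM (deriv h z) (conj (deriv g z)) : ℂ →ₗ[ℝ] ℂ)
    (wirtingerCLM_injective hab)).toContinuousLinearEquiv
  have h1 : HasStrictFDerivAt f (wirtingerCLM (deriv h z) (conj (deriv g z))) z :=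
    (D.harmonicOnNhd z hz).1.hasStrictFDerivAt' (D.hasWirtingerAt hz) two_ne_zero
  have h2 : HasStrictFDerivAt f (L : ℂ →L[ℝ] ℂ) z := h1
  exact ⟨_, (h2.toOpenPartialHomeomorph f).open_source.mem_nhds
    h2.mem_toOpenPartialHomeomorph_source, (h2.toOpenPartialHomeomorph f).injOn⟩

/-- Lewy's theorem in one direction, the inverse function theorem in the other. -/
theorem Decomposition.isLocallyUnivalentHarmonic_iff {Ω : Set ℂ} {f g h : ℂ → ℂ}
    (D : Decomposition Ω f g h) :
    IsLocallyUnivalentHarmonic Ω f ↔ ∀ z ∈ Ω, jacobian f z ≠ 0 :=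
  ⟨fun hf z hz => let ⟨_, hU, hinj⟩ := hf.2 z hz; D.jacobian_ne_zero hz hU hinj,
    fun hJ => ⟨D.harmonicOnNhd, fun z hz => D.exists_injOn hz (hJ z hz)⟩⟩

end

/-! ### Polarization, and elimination for polynomial identities. -/

section

/-- Real zeros accumulate at 0, so the identity theorem applies. Used once in each variable, it
passes from real pairs (x, y) to complex ones. -/
theorem eq_zero_on_ball_of_real {φ : ℂ → ℂ} {r : ℝ} (hφ : DifferentiableOn ℂ φ (ball 0 r))
    (h0 : ∀ t : ℝ, |t| < r → φ t = 0) : ∀ x ∈ ball (0 : ℂ) r, φ x = 0 := by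
  intro x hx
  have hr : 0 < r := (norm_nonneg x).trans_lt (mem_ball_zero_iff.1 hx)
  have hfr : ∃ᶠ z in 𝓝[≠] (0 : ℂ), φ z = 0 := by
    have h1 : Tendsto (fun t : ℝ => (t : ℂ)) (𝓝[≠] 0) (𝓝[≠] 0) := by
      refine tendsto_nhdsWithin_iff.2 ⟨?_, ?_⟩
      · exact (Complex.continuous_ofReal.tendsto' 0 0 Complex.ofReal_zero).mono_left
          nhdsWithin_le_nhds
      · filter_upwards [self_mem_nhdsWithin] with t ht using by simpa using ht
    refine h1.frequently (Eventually.frequently ?_)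
    have h2 : ∀ᶠ t : ℝ in 𝓝 0, |t| < r := by
      filter_upwards [ball_mem_nhds (0 : ℝ) hr] with t ht using by simpa using ht
    filter_upwards [nhdsWithin_le_nhds h2] with t ht using h0 t ht
  exact (hφ.analyticOnNhd isOpen_ball).eqOn_zero_of_preconnected_of_frequently_eq_zero
    (convex_ball _ _).isPreconnected (mem_ball_self hr) hfr hx

/-- Polarization: a function `K(z, w)`, holomorphic for `z ∈ Ω` and `conj w ∈ Ω`, that vanishes for
`w = conj z` vanishes identically. -/
theorem eq_zero_of_polarization {Ω : Set ℂ} (hΩ : IsOpen Ω) (hc : IsPreconnected Ω)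
    {K : ℂ × ℂ → ℂ} (hK : ∀ x : ℂ × ℂ, x.1 ∈ Ω → conj x.2 ∈ Ω → DifferentiableAt ℂ K x)
    (h0 : ∀ z ∈ Ω, K (z, conj z) = 0) : ∀ z ∈ Ω, ∀ w ∈ Ω, K (z, conj w) = 0 := by
  intro z hz w hw
  obtain ⟨r, hr, hrΩ⟩ := isOpen_iff.1 hΩ w hw
  have hmem : ∀ x ∈ ball (0 : ℂ) (r / 2), ∀ y ∈ ball (0 : ℂ) (r / 2),
      w + (x + Complex.I * y) ∈ Ω ∧ conj (conj w + (x - Complex.I * y)) ∈ Ω := by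
    intro x hx y hy
    rw [mem_ball_zero_iff] at hx hy
    have hIy : ‖Complex.I * y‖ < r / 2 := by simpa using hy
    constructor
    · apply hrΩ
      rw [mem_ball, dist_eq_norm, add_sub_cancel_left]
      exact (norm_add_le _ _).trans_lt (by linarith)
    · apply hrΩ
      rw [map_add, Complex.conj_conj, mem_ball, dist_eq_norm, add_sub_cancel_left, RCLike.norm_conj]
      exact (norm_sub_le _ _).trans_lt (by linarith)
  -- In these coordinates the points with second entry conjugate to the first are those with x, y
  -- real.
  let L : ℂ → ℂ → ℂ := fun x y => K (w + (x + Complex.I * y), conj w + (x - Complex.I * y))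
  have hLx : ∀ y ∈ ball (0 : ℂ) (r / 2), DifferentiableOn ℂ (fun x => L x y) (ball 0 (r / 2)) := by
    intro y hy x hx
    have h1 := hmem x hx y hy
    exact (DifferentiableAt.comp x (hK _ h1.1 h1.2)
      (f := fun x : ℂ => (w + (x + Complex.I * y), conj w + (x - Complex.I * y)))
      (by fun_prop)).differentiableWithinAt
  have hLy : ∀ x ∈ ball (0 : ℂ) (r / 2), DifferentiableOn ℂ (fun y => L x y) (ball 0 (r / 2)) := by
    intro x hx y hy
    have h1 := hmem x hx y hy
    exact (DifferentiableAt.comp y (hK _ h1.1 h1.2)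
      (f := fun y : ℂ => (w + (x + Complex.I * y), conj w + (x - Complex.I * y)))
      (by fun_prop)).differentiableWithinAt
  have hreal : ∀ t : ℝ, |t| < r / 2 → (t : ℂ) ∈ ball (0 : ℂ) (r / 2) := fun t ht => by simpa using ht
  have hL0 : ∀ x ∈ ball (0 : ℂ) (r / 2), ∀ y ∈ ball (0 : ℂ) (r / 2), L x y = 0 := by
    intro x hx
    refine eq_zero_on_ball_of_real (hLy x hx) fun t ht => ?_
    refine eq_zero_on_ball_of_real (hLx t (hreal t ht)) (fun s hs => ?_) x hx
    have h1 := h0 _ (hmem s (hreal s hs) t (hreal t ht)).1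
    simpa [L, sub_eq_add_neg] using h1
  have hev : ∀ᶠ v in 𝓝 w, K (v, conj w) = 0 := by
    filter_upwards [ball_mem_nhds w (half_pos hr)] with v hv
    rw [mem_ball, dist_eq_norm] at hv
    -- This x and y solve x + i y = v - w and x - i y = 0, which keeps the second argument at conj
    -- w.
    have h1 := hL0 ((v - w) / 2) (by
      rw [mem_ball_zero_iff, norm_div]; simp; linarith [norm_nonneg (v - w)])
      (-Complex.I * (v - w) / 2) (by
      rw [mem_ball_zero_iff, norm_div, norm_mul]; simp; linarith [norm_nonneg (v - w)])
    have h2 : Complex.I * (-Complex.I * (v - w) / 2) = (v - w) / 2 := by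
      linear_combination (-(v - w) / 2) * Complex.I_mul_I
    simp only [L, h2, sub_self, add_zero] at h1
    rw [← h1]
    congr 2
    ring
  have hKz : AnalyticOnNhd ℂ (fun v => K (v, conj w)) Ω := by
    refine DifferentiableOn.analyticOnNhd (fun v hv => ?_) hΩ
    exact (DifferentiableAt.comp v (hK (v, conj w) hv (by simpa using hw))
      (f := fun v : ℂ => (v, conj w)) (by fun_prop)).differentiableWithinAt
  exact hKz.eqOn_zero_of_preconnected_of_eventuallyEq_zero hc hw hev hz

/-- Keeps the polarized Jacobian p(z) conj p(w) - q(z) conj q(w) away from zero for all z, w; this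
is where sense-preservation is needed. -/
theorem mul_sub_mul_ne_zero {a b c d : ℂ} (h1 : ‖b‖ < ‖a‖) (h2 : ‖d‖ < ‖c‖) :
    a * c - b * d ≠ 0 := by
  intro h
  have h3 := congrArg norm (sub_eq_zero.1 h)
  rw [norm_mul, norm_mul] at h3
  have := mul_lt_mul'' h1 h2 (norm_nonneg _) (norm_nonneg _)
  linarith

theorem differentiableAt_conj_comp_conj {p : ℂ → ℂ} {w : ℂ} (hp : DifferentiableAt ℂ p (conj w)) :
    DifferentiableAt ℂ (fun v => conj (p (conj v))) w := by
  simpa [Function.comp_def] using hp.conj_conj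

theorem differentiableAt_schwarzianKernel {Ω : Set ℂ} (hΩ : IsOpen Ω) {p q : ℂ → ℂ}
    (hp : DifferentiableOn ℂ p Ω) (hq : DifferentiableOn ℂ q Ω) (hpq : ∀ z ∈ Ω, ‖q z‖ < ‖p z‖)
    {x : ℂ × ℂ} (hx : x.1 ∈ Ω) (hx' : conj x.2 ∈ Ω) :
    DifferentiableAt ℂ (fun x : ℂ × ℂ =>
      schwarzianKernel p q x.1 (conj (p (conj x.2))) (conj (q (conj x.2)))) x := by
  have D : ∀ {r : ℂ → ℂ}, DifferentiableOn ℂ r Ω →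
      DifferentiableAt ℂ (fun x : ℂ × ℂ => r x.1) x := fun hr =>
    DifferentiableAt.comp x (hr.differentiableAt (hΩ.mem_nhds hx)) differentiableAt_fst
  have E : ∀ {r : ℂ → ℂ}, DifferentiableOn ℂ r Ω →
      DifferentiableAt ℂ (fun x : ℂ × ℂ => conj (r (conj x.2))) x := fun {r} hr =>
    DifferentiableAt.comp x (g := fun v => conj (r (conj v)))
      (differentiableAt_conj_comp_conj (hr.differentiableAt (hΩ.mem_nhds hx'))) differentiableAt_snd
  have hp1 := hp.deriv hΩ
  have hq1 := hq.deriv hΩ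
  have d0 := D hp
  have d1 := D hp1
  have d2 := D (hp1.deriv hΩ)
  have e0 := D hq
  have e1 := D hq1
  have e2 := D (hq1.deriv hΩ)
  have c0 := E hp
  have c1 := E hq
  have hne : p x.1 * conj (p (conj x.2)) - q x.1 * conj (q (conj x.2)) ≠ 0 :=
    mul_sub_mul_ne_zero (hpq _ hx) (by simpa using hpq _ hx')
  have hden := (d0.fun_mul c0).fun_sub (e0.fun_mul c1)
  have hN₂ := ((d2.fun_mul c0).fun_sub (e2.fun_mul c1)).fun_mul (hden.fun_inv hne)
  have hN₁ := ((d1.fun_mul c0).fun_sub (e1.fun_mul c1)).fun_mul (hden.fun_inv hne)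
  simpa only [schwarzianKernel, div_eq_mul_inv] using hN₂.fun_sub ((hN₁.fun_pow 2).const_mul (3 / 2))

/-- Decouples z from w, so that z can be frozen while the conjugated values vary. -/
theorem schwarzianKernel_eq_of_diagonal {Ω : Set ℂ} (hΩ : IsOpen Ω) (hc : IsPreconnected Ω)
    {p q P Q : ℂ → ℂ} (hp : DifferentiableOn ℂ p Ω) (hq : DifferentiableOn ℂ q Ω)
    (hP : DifferentiableOn ℂ P Ω) (hQ : DifferentiableOn ℂ Q Ω)
    (hpq : ∀ z ∈ Ω, ‖q z‖ < ‖p z‖) (hPQ : ∀ z ∈ Ω, ‖Q z‖ < ‖P z‖)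
    (h : ∀ z ∈ Ω, schwarzianKernel p q z (conj (p z)) (conj (q z)) =
      schwarzianKernel P Q z (conj (P z)) (conj (Q z))) :
    ∀ z ∈ Ω, ∀ w ∈ Ω, schwarzianKernel p q z (conj (p w)) (conj (q w)) =
      schwarzianKernel P Q z (conj (P w)) (conj (Q w)) := by
  intro z hz w hw
  have h1 := eq_zero_of_polarization hΩ hc
    (fun x hx hx' => (differentiableAt_schwarzianKernel hΩ hp hq hpq hx hx').sub
      (differentiableAt_schwarzianKernel hΩ hP hQ hPQ hx hx'))
    (fun z hz => by simpa [sub_eq_zero] using h z hz) z hz w hw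
  simpa [sub_eq_zero] using h1

open Polynomial in
theorem coeffs_eq_zero_of_infinite {S : Set ℂ} (hS : S.Infinite) {c₀ c₁ c₂ c₃ c₄ c₅ : ℂ}
    (h : ∀ u ∈ S, c₅ * u ^ 5 + c₄ * u ^ 4 + c₃ * u ^ 3 + c₂ * u ^ 2 + c₁ * u + c₀ = 0) :
    c₀ = 0 ∧ c₁ = 0 ∧ c₂ = 0 ∧ c₃ = 0 ∧ c₄ = 0 ∧ c₅ = 0 := by
  set r : ℂ[X] := C c₅ * X ^ 5 + C c₄ * X ^ 4 + C c₃ * X ^ 3 + C c₂ * X ^ 2 + C c₁ * X + C c₀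
    with hr
  have h0 : r = 0 := eq_zero_of_infinite_isRoot r (hS.mono fun u hu => by
    simpa [hr, IsRoot] using h u hu)
  have hco : ∀ n, r.coeff n = 0 := fun n => by rw [h0, coeff_zero]
  refine ⟨by simpa [hr, coeff_X, coeff_C] using hco 0, by simpa [hr, coeff_X, coeff_C] using hco 1,
    by simpa [hr, coeff_X, coeff_C] using hco 2, by simpa [hr, coeff_X, coeff_C] using hco 3,
    by simpa [hr, coeff_X, coeff_C] using hco 4, by simpa [hr, coeff_X, coeff_C] using hco 5⟩

/-- If `U² - u²` and a difference of cubics in `U` and `u` with the same leading coefficient are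
constant, then `U = u` except for at most two values of `u`. -/
theorem exists_mul_eq_zero_of_cubic {ι : Type*} {u U : ι → ℂ} (hu : (range u).Infinite)
    {k A₀ A₁ A₂ a₀ a₁ a₂ : ℂ} (h2 : ∀ i, U i ^ 2 = u i ^ 2 + k)
    (h3 : ∀ i, 3 * U i ^ 3 + A₂ * U i ^ 2 + A₁ * U i + A₀ =
      3 * u i ^ 3 + a₂ * u i ^ 2 + a₁ * u i + a₀) :
    ∃ e, ∀ i, (U i - u i) * (u i ^ 2 + e) = 0 := by
  -- Substituting U² = u² + k makes the cubic relation linear in U.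
  have h4 : ∀ i, U i * (3 * u i ^ 2 + (3 * k + A₁)) =
      3 * u i ^ 3 + (a₂ - A₂) * u i ^ 2 + a₁ * u i + (a₀ - A₀ - A₂ * k) := fun i => by
    linear_combination h3 i - (3 * U i + A₂) * h2 i
  generalize hE : 3 * k + A₁ = E at h4
  generalize a₂ - A₂ = n₂ at h4
  generalize a₀ - A₀ - A₂ * k = n₀ at h4
  -- Squaring the linear relation and replacing U² removes U. The terms in u⁶ cancel because the
  -- leading coefficients agree, and every remaining coefficient must vanish.
  obtain ⟨e0, e1, e2, e3, e4, e5⟩ := coeffs_eq_zero_of_infinite hu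
    (c₅ := -6 * n₂) (c₄ := 6 * E + 9 * k - n₂ ^ 2 - 6 * a₁) (c₃ := -6 * n₀ - 2 * n₂ * a₁)
    (c₂ := E ^ 2 + 6 * E * k - a₁ ^ 2 - 2 * n₂ * n₀) (c₁ := -2 * a₁ * n₀)
    (c₀ := k * E ^ 2 - n₀ ^ 2) (by
      rintro _ ⟨i, rfl⟩
      linear_combination (U i * (3 * u i ^ 2 + E) +
        (3 * u i ^ 3 + n₂ * u i ^ 2 + a₁ * u i + n₀)) * h4 i - (3 * u i ^ 2 + E) ^ 2 * h2 i)
  have hn2 : n₂ = 0 := by simpa using e5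
  subst hn2
  have hn0 : n₀ = 0 := by simpa using e3
  subst hn0
  have hk : k = 0 := by
    by_contra hk
    have hE0 : E = 0 := by simpa [hk] using e0
    subst hE0
    have ha : a₁ = 0 := by simpa using e2
    subst ha
    exact hk (by simpa using e4)
  subst hk
  refine ⟨E / 3, fun i => ?_⟩
  have ha : a₁ = E := by linear_combination (-1 / 6) * e4
  subst ha
  linear_combination (1 / 3) * h4 i

/-- A quadratic and a cubic polynomial cannot both be affine functions of one quantity. -/
theorem false_of_quadratic_cubic_linear {ι : Type*} {u T : ι → ℂ} (hu : (range u).Infinite)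
    {b c B C a₀ a₁ a₂ k : ℂ} (h2 : ∀ i, u i ^ 2 + k = b * T i + c)
    (h3 : ∀ i, 3 * u i ^ 3 + a₂ * u i ^ 2 + a₁ * u i + a₀ = B * T i + C) : False := by
  -- Eliminating T leaves a polynomial with leading term 3 b u³, so b = 0; then u² would be
  -- constant.
  obtain ⟨-, -, -, e3, -, -⟩ := coeffs_eq_zero_of_infinite hu (c₅ := 0) (c₄ := 0) (c₃ := 3 * b)
    (c₂ := b * a₂ - B) (c₁ := b * a₁) (c₀ := b * a₀ - B * k + B * c - b * C) (by
      rintro _ ⟨i, rfl⟩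
      linear_combination b * h3 i - B * h2 i)
  have hb : b = 0 := by simpa using e3
  subst hb
  obtain ⟨-, -, e2, -, -, -⟩ := coeffs_eq_zero_of_infinite hu (c₅ := 0) (c₄ := 0) (c₃ := 0)
    (c₂ := 1) (c₁ := 0) (c₀ := k - c) (by
      rintro _ ⟨i, rfl⟩
      linear_combination h2 i)
  exact one_ne_zero e2

end

/-! ### Schwarzian derivatives of the pencil h + t g. -/

section

/-- The Schwarzian derivative of `h + t g` at `z`, where `p = h'` and `q = g'`. -/
def pencilSchwarzian (p q : ℂ → ℂ) (t z : ℂ) : ℂ :=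
  (deriv (deriv p) z + t * deriv (deriv q) z) / (p z + t * q z) -
    3 / 2 * ((deriv p z + t * deriv q z) / (p z + t * q z)) ^ 2

/-- The kernel is homogeneous of degree 0 in (a, b), so only the ratio matters. -/
theorem schwarzianKernel_eq_pencilSchwarzian (p q : ℂ → ℂ) (z : ℂ) {a : ℂ} (b : ℂ) (ha : a ≠ 0) :
    schwarzianKernel p q z a b = pencilSchwarzian p q (-(b / a)) z := by
  have h : ∀ x y : ℂ, x * a - y * b = (x + -(b / a) * y) * a := fun x y => by field_simp; ring
  simp only [schwarzianKernel, pencilSchwarzian, h, mul_div_mul_right _ _ ha]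

theorem hasDerivAt_schwarzian {X : ℂ → ℂ} {z : ℂ} (hX : AnalyticAt ℂ X z) (h0 : X z ≠ 0) :
    HasDerivAt (fun w => deriv (deriv X) w / X w - 3 / 2 * (deriv X w / X w) ^ 2)
      (deriv (deriv (deriv X)) z / X z - 4 * (deriv X z / X z) * (deriv (deriv X) z / X z) +
        3 * (deriv X z / X z) ^ 3) z := by
  have d0 := hX.differentiableAt.hasDerivAt
  have d1 := hX.deriv.differentiableAt.hasDerivAt
  have d2 := hX.deriv.deriv.differentiableAt.hasDerivAt
  have h := (d2.fun_div d0 h0).fun_sub (((d1.fun_div d0 h0).fun_pow 2).const_mul (3 / 2))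
  refine h.congr_deriv ?_
  simp only [Nat.reduceSub, pow_one, Nat.cast_ofNat]
  field_simp
  ring

section

variable {Ω : Set ℂ} {p q : ℂ → ℂ}

theorem deriv_pencil (hΩ : IsOpen Ω) (hp : DifferentiableOn ℂ p Ω) (hq : DifferentiableOn ℂ q Ω)
    (t : ℂ) {z : ℂ} (hz : z ∈ Ω) :
    deriv (fun w => p w + t * q w) z = deriv p z + t * deriv q z :=
  ((hp.differentiableAt (hΩ.mem_nhds hz)).hasDerivAt.fun_add
    ((hq.differentiableAt (hΩ.mem_nhds hz)).hasDerivAt.const_mul t)).deriv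

theorem deriv_deriv_pencil (hΩ : IsOpen Ω) (hp : DifferentiableOn ℂ p Ω)
    (hq : DifferentiableOn ℂ q Ω) (t : ℂ) {z : ℂ} (hz : z ∈ Ω) :
    deriv (deriv fun w => p w + t * q w) z = deriv (deriv p) z + t * deriv (deriv q) z := by
  have h : deriv (fun w => p w + t * q w) =ᶠ[𝓝 z] fun w => deriv p w + t * deriv q w := by
    filter_upwards [hΩ.mem_nhds hz] with w hw using deriv_pencil hΩ hp hq t hw
  rw [h.deriv_eq]
  exact deriv_pencil hΩ (hp.deriv hΩ) (hq.deriv hΩ) t hz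

theorem pencilSchwarzian_eq (hΩ : IsOpen Ω) (hp : DifferentiableOn ℂ p Ω)
    (hq : DifferentiableOn ℂ q Ω) (t : ℂ) {z : ℂ} (hz : z ∈ Ω) :
    pencilSchwarzian p q t z = deriv (deriv fun w => p w + t * q w) z / (p z + t * q z) -
      3 / 2 * (deriv (fun w => p w + t * q w) z / (p z + t * q z)) ^ 2 := by
  rw [pencilSchwarzian, deriv_pencil hΩ hp hq t hz, deriv_deriv_pencil hΩ hp hq t hz]

/-- At a zero of q the denominator p + t q loses its dependence on t, so the derivative of the
Schwarzian is a polynomial in t of degree at most 3. -/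
theorem hasDerivAt_pencilSchwarzian (hΩ : IsOpen Ω) (hp : DifferentiableOn ℂ p Ω)
    (hq : DifferentiableOn ℂ q Ω) (t : ℂ) {z : ℂ} (hz : z ∈ Ω) (hq0 : q z = 0) (hp0 : p z ≠ 0) :
    HasDerivAt (pencilSchwarzian p q t)
      ((deriv (deriv (deriv p)) z + t * deriv (deriv (deriv q)) z) / p z -
        4 * ((deriv p z + t * deriv q z) / p z) *
          ((deriv (deriv p) z + t * deriv (deriv q) z) / p z) +
        3 * ((deriv p z + t * deriv q z) / p z) ^ 3) z := by
  have hX : AnalyticAt ℂ (fun w => p w + t * q w) z :=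
    (hp.add (hq.const_mul t)).analyticAt (hΩ.mem_nhds hz)
  have h := hasDerivAt_schwarzian hX (by simpa [hq0] using hp0)
  have h3 : deriv (deriv (deriv fun w => p w + t * q w)) z =
      deriv (deriv (deriv p)) z + t * deriv (deriv (deriv q)) z := by
    have he : deriv (fun w => p w + t * q w) =ᶠ[𝓝 z] fun w => deriv p w + t * deriv q w := by
      filter_upwards [hΩ.mem_nhds hz] with w hw using deriv_pencil hΩ hp hq t hw
    rw [he.deriv.deriv_eq]
    exact deriv_deriv_pencil hΩ (hp.deriv hΩ) (hq.deriv hΩ) t hz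
  rw [h3, deriv_pencil hΩ hp hq t hz, deriv_deriv_pencil hΩ hp hq t hz, hq0, mul_zero,
    add_zero] at h
  refine h.congr_of_eventuallyEq ?_
  filter_upwards [hΩ.mem_nhds hz] with w hw using pencilSchwarzian_eq hΩ hp hq t hw

end

/-- Two families of Schwarzian two-jets that agree: the parameters are proportional, away from
finitely many exceptional values. -/
theorem exists_mul_eq_zero_of_jets {ι : Type*} {t T : ι → ℂ} (ht : (range t).Infinite)
    {α₁ α₂ α₃ β₁ β₂ β₃ A₁ A₂ A₃ B₁ B₂ B₃ : ℂ} (hβ : β₁ ≠ 0)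
    (h1 : ∀ i, (α₂ + t i * β₂) - 3 / 2 * (α₁ + t i * β₁) ^ 2 =
      (A₂ + T i * B₂) - 3 / 2 * (A₁ + T i * B₁) ^ 2)
    (h2 : ∀ i, (α₃ + t i * β₃) - 4 * (α₁ + t i * β₁) * (α₂ + t i * β₂) +
        3 * (α₁ + t i * β₁) ^ 3 =
      (A₃ + T i * B₃) - 4 * (A₁ + T i * B₁) * (A₂ + T i * B₂) + 3 * (A₁ + T i * B₁) ^ 3) :
    B₁ ≠ 0 ∧ ∃ s s' e : ℂ, ∀ i, (T i * B₁ - t i * β₁ - s) * ((t i * β₁ - s') ^ 2 + e) = 0 := by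
  obtain ⟨b₂, rfl⟩ : ∃ b₂, β₂ = β₁ * b₂ := ⟨β₂ / β₁, by field_simp⟩
  obtain ⟨b₃, rfl⟩ : ∃ b₃, β₃ = β₁ * b₃ := ⟨β₃ / β₁, by field_simp⟩
  -- The shift by b₂/3 completes the square in `h1`, which after multiplication by -2/3 reads u² +
  -- const on the left.
  set u : ι → ℂ := fun i => α₁ + t i * β₁ - b₂ / 3 with hu
  have hui : (range u).Infinite := by
    have h := ht.image (f := fun x => α₁ + x * β₁ - b₂ / 3) (fun x _ y _ hxy => by
      have : x * β₁ = y * β₁ := by linear_combination hxy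
      exact mul_right_cancel₀ hβ this)
    rwa [← range_comp] at h
  have htu : ∀ i, t i * β₁ = u i + b₂ / 3 - α₁ := fun i => by simp only [hu]; ring
  -- With B₁ = 0 both right-hand sides would be affine in T, while the left-hand sides are a
  -- quadratic and a cubic in u.
  have hB : B₁ ≠ 0 := by
    rintro rfl
    refine false_of_quadratic_cubic_linear (u := u) (T := T) hui
      (b := -2 / 3 * B₂) (c := -2 / 3 * A₂ + A₁ ^ 2)
      (k := -2 / 3 * (α₂ - α₁ * b₂) - b₂ ^ 2 / 9)
      (B := B₃ - 4 * A₁ * B₂) (C := A₃ - 4 * A₁ * A₂ + 3 * A₁ ^ 3)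
      (a₂ := -b₂) (a₁ := b₃ - 5 / 3 * b₂ ^ 2 - 4 * (α₂ - α₁ * b₂))
      (a₀ := α₃ + (b₂ / 3 - α₁) * b₃ - 4 * (b₂ / 3) * (α₂ + (b₂ / 3 - α₁) * b₂) + b₂ ^ 3 / 9)
      (fun i => ?_) (fun i => ?_)
    · have h := h1 i
      rw [← mul_assoc, htu] at h
      linear_combination (-2 / 3) * h
    · have h := h2 i
      simp only [← mul_assoc] at h
      rw [htu] at h
      linear_combination h
  refine ⟨hB, ?_⟩
  obtain ⟨c₂, rfl⟩ : ∃ c₂, B₂ = B₁ * c₂ := ⟨B₂ / B₁, by field_simp⟩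
  obtain ⟨c₃, rfl⟩ : ∃ c₃, B₃ = B₁ * c₃ := ⟨B₃ / B₁, by field_simp⟩
  set U : ι → ℂ := fun i => A₁ + T i * B₁ - c₂ / 3 with hU
  have hTU : ∀ i, T i * B₁ = U i + c₂ / 3 - A₁ := fun i => by simp only [hU]; ring
  obtain ⟨e, he⟩ := exists_mul_eq_zero_of_cubic (u := u) (U := U) hui
    (k := -2 / 3 * (α₂ - α₁ * b₂) - b₂ ^ 2 / 9 - (-2 / 3 * (A₂ - A₁ * c₂) - c₂ ^ 2 / 9))
    (a₂ := -b₂) (a₁ := b₃ - 5 / 3 * b₂ ^ 2 - 4 * (α₂ - α₁ * b₂))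
    (a₀ := α₃ + (b₂ / 3 - α₁) * b₃ - 4 * (b₂ / 3) * (α₂ + (b₂ / 3 - α₁) * b₂) + b₂ ^ 3 / 9)
    (A₂ := -c₂) (A₁ := c₃ - 5 / 3 * c₂ ^ 2 - 4 * (A₂ - A₁ * c₂))
    (A₀ := A₃ + (c₂ / 3 - A₁) * c₃ - 4 * (c₂ / 3) * (A₂ + (c₂ / 3 - A₁) * c₂) + c₂ ^ 3 / 9)
    (fun i => by
      have h := h1 i
      rw [← mul_assoc, ← mul_assoc, htu, hTU] at h
      linear_combination (2 / 3) * h)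
    (fun i => by
      have h := h2 i
      simp only [← mul_assoc] at h
      rw [htu, hTU] at h
      linear_combination -h)
  refine ⟨α₁ - b₂ / 3 - (A₁ - c₂ / 3), b₂ / 3 - α₁, e, fun i => ?_⟩
  rw [← he i]
  simp only [hu, hU]
  ring

end

/-! ### Rigidity when both dilatations vanish at a common point. -/

section

variable {Ω : Set ℂ} {p q P Q : ℂ → ℂ}

theorem ne_zero_of_norm_lt {a b : ℂ} (h : ‖b‖ < ‖a‖) : a ≠ 0 :=
  norm_pos_iff.1 ((norm_nonneg b).trans_lt h)

/-- A connected set with two points is infinite; were the image a single point, q would vanish near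
z₀, against q'(z₀) ≠ 0. -/
theorem infinite_range_dilatation (hΩ : IsOpen Ω) (hc : IsPreconnected Ω)
    (hp : DifferentiableOn ℂ p Ω) (hq : DifferentiableOn ℂ q Ω) (hp0 : ∀ z ∈ Ω, p z ≠ 0)
    {z₀ : ℂ} (hz₀ : z₀ ∈ Ω) (hq0 : q z₀ = 0) (hq1 : deriv q z₀ ≠ 0) :
    (range fun w : Ω => -(conj (q w) / conj (p w))).Infinite := by
  have hcont : ContinuousOn (fun w => -(conj (q w) / conj (p w))) Ω := by
    have h1 := hp.continuousOn
    have h2 := hq.continuousOn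
    exact ((Complex.continuous_conj.comp_continuousOn h2).div
      (Complex.continuous_conj.comp_continuousOn h1) fun w hw => by simpa using hp0 w hw).neg
  have hr : (range fun w : Ω => -(conj (q w) / conj (p w))) =
      (fun w => -(conj (q w) / conj (p w))) '' Ω := by
    rw [image_eq_range]
  rw [hr]
  refine (hc.image _ hcont).infinite_of_nontrivial ?_
  by_contra hnt
  rw [not_nontrivial_iff] at hnt
  refine hq1 ?_
  have hev : q =ᶠ[𝓝 z₀] fun _ => 0 := by
    filter_upwards [hΩ.mem_nhds hz₀] with w hw
    have := hnt (mem_image_of_mem _ hw) (mem_image_of_mem _ hz₀)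
    simpa [hq0, hp0 w hw] using this
  rw [hev.deriv_eq, deriv_const]

/-- With both dilatations vanishing at `z₀`, equality of the Schwarzian pencils makes the
dilatations proportional, by a factor of modulus one. -/
theorem exists_dilatation_eq (hΩ : IsOpen Ω) (hc : IsPreconnected Ω)
    (hp : DifferentiableOn ℂ p Ω) (hq : DifferentiableOn ℂ q Ω)
    (hP : DifferentiableOn ℂ P Ω) (hQ : DifferentiableOn ℂ Q Ω)
    (hp0 : ∀ z ∈ Ω, p z ≠ 0) (hP0 : ∀ z ∈ Ω, P z ≠ 0)
    {z₀ : ℂ} (hz₀ : z₀ ∈ Ω) (hq0 : q z₀ = 0) (hQ0 : Q z₀ = 0) (hq1 : deriv q z₀ ≠ 0)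
    (h : ∀ z ∈ Ω, ∀ w ∈ Ω, pencilSchwarzian p q (-(conj (q w) / conj (p w))) z =
      pencilSchwarzian P Q (-(conj (Q w) / conj (P w))) z) :
    ∃ κ : ℂ, ‖κ‖ = 1 ∧ ∀ z ∈ Ω, Q z / P z = κ * (q z / p z) := by
  have hinf := infinite_range_dilatation hΩ hc hp hq hp0 hz₀ hq0 hq1
  have hpz := hp0 z₀ hz₀
  have hPz := hP0 z₀ hz₀
  have hβ : deriv q z₀ / p z₀ ≠ 0 := div_ne_zero hq1 hpz
  obtain ⟨hB, s, s', e, hmul⟩ := exists_mul_eq_zero_of_jets (ι := Ω)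
    (t := fun w => -(conj (q w) / conj (p w))) (T := fun w => -(conj (Q w) / conj (P w))) hinf
    (α₁ := deriv p z₀ / p z₀) (α₂ := deriv (deriv p) z₀ / p z₀)
    (α₃ := deriv (deriv (deriv p)) z₀ / p z₀) (β₁ := deriv q z₀ / p z₀)
    (β₂ := deriv (deriv q) z₀ / p z₀) (β₃ := deriv (deriv (deriv q)) z₀ / p z₀)
    (A₁ := deriv P z₀ / P z₀) (A₂ := deriv (deriv P) z₀ / P z₀)
    (A₃ := deriv (deriv (deriv P)) z₀ / P z₀) (B₁ := deriv Q z₀ / P z₀)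
    (B₂ := deriv (deriv Q) z₀ / P z₀) (B₃ := deriv (deriv (deriv Q)) z₀ / P z₀) hβ
    (fun w => by
      have h1 := h z₀ hz₀ w w.2
      simp only [pencilSchwarzian, hq0, hQ0, mul_zero, add_zero] at h1
      simp only [← mul_div_assoc, ← add_div]
      exact h1)
    (fun w => by
      have h1 := hasDerivAt_pencilSchwarzian hΩ hp hq (-(conj (q w) / conj (p w))) hz₀ hq0 hpz
      have h2 := hasDerivAt_pencilSchwarzian hΩ hP hQ (-(conj (Q w) / conj (P w))) hz₀ hQ0 hPz
      have h3 := h1.unique (h2.congr_of_eventuallyEq (by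
        filter_upwards [hΩ.mem_nhds hz₀] with z hz using h z hz w w.2))
      simp only [← mul_div_assoc, ← add_div] at h3 ⊢
      exact h3)
  set β := deriv q z₀ / p z₀ with hβdef
  set B := deriv Q z₀ / P z₀ with hBdef
  have hω : DifferentiableOn ℂ (fun w => q w / p w) Ω := hq.div hp hp0
  have hW : DifferentiableOn ℂ (fun w => Q w / P w) Ω := hQ.div hP hP0
  -- Conjugation makes both factors analytic in w, so one of them vanishes identically.
  have hconj : ∀ w ∈ Ω, (-(Q w / P w) * conj B + q w / p w * conj β - conj s) *
      ((-(q w / p w) * conj β - conj s') ^ 2 + conj e) = 0 := fun w hw => by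
    have h1 := congrArg conj (hmul ⟨w, hw⟩)
    simp only [map_mul, map_sub, map_add, map_neg, map_div₀, map_pow, Complex.conj_conj,
      map_zero] at h1
    rw [← h1]
    ring
  rcases AnalyticOnNhd.eq_zero_or_eq_zero_of_mul_eq_zero
    (f := fun w => -(Q w / P w) * conj B + q w / p w * conj β - conj s)
    (g := fun w => (-(q w / p w) * conj β - conj s') ^ 2 + conj e)
    (DifferentiableOn.analyticOnNhd (((hW.neg.mul_const _).add (hω.mul_const _)).sub_const _) hΩ)
    (DifferentiableOn.analyticOnNhd ((((hω.neg.mul_const _).sub_const _).pow 2).add_const _) hΩ)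
    hconj hc with h1 | h1
  · have hs : conj s = 0 := by simpa [hq0, hQ0] using h1 z₀ hz₀
    have hBc : conj B ≠ 0 := by simpa using hB
    have hrel : ∀ z ∈ Ω, Q z / P z = conj β / conj B * (q z / p z) := fun z hz => by
      have h2 := h1 z hz
      simp only [hs, sub_zero] at h2
      field_simp
      linear_combination (-1) * h2
    have hdq : HasDerivAt (fun z => q z / p z) β z₀ := by
      have h2 := ((hq.differentiableAt (hΩ.mem_nhds hz₀)).hasDerivAt).fun_div
        ((hp.differentiableAt (hΩ.mem_nhds hz₀)).hasDerivAt) hpz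
      refine h2.congr_deriv ?_
      rw [hq0, hβdef]
      field_simp
      ring
    have hdQ : HasDerivAt (fun z => Q z / P z) B z₀ := by
      have h2 := ((hQ.differentiableAt (hΩ.mem_nhds hz₀)).hasDerivAt).fun_div
        ((hP.differentiableAt (hΩ.mem_nhds hz₀)).hasDerivAt) hPz
      refine h2.congr_deriv ?_
      rw [hQ0, hBdef]
      field_simp
      ring
    have hdQ' := (hdq.const_mul (conj β / conj B)).congr_of_eventuallyEq (f₁ := fun z => Q z / P z)
      (by filter_upwards [hΩ.mem_nhds hz₀] with z hz using hrel z hz)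
    -- Comparing derivatives at z₀ gives |B|² = |β|², so the factor conj β / conj B has modulus one.
    have hBeq : B = conj β / conj B * β := hdQ.unique hdQ'
    have hnorm : ‖B‖ = ‖β‖ := by
      have h2 : B * conj B = β * conj β := by
        rw [div_mul_eq_mul_div, eq_div_iff hBc] at hBeq
        linear_combination hBeq
      rw [Complex.mul_conj', Complex.mul_conj'] at h2
      have h3 : ‖B‖ ^ 2 = ‖β‖ ^ 2 := by exact_mod_cast h2
      exact (sq_eq_sq₀ (norm_nonneg _) (norm_nonneg _)).1 h3
    refine ⟨conj β / conj B, ?_, hrel⟩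
    rw [norm_div, RCLike.norm_conj, RCLike.norm_conj, hnorm, div_self (norm_ne_zero_iff.2 hβ)]
  -- The second factor would confine t to finitely many values.
  · exfalso
    have hconst : ∀ w : Ω, -(conj (q w) / conj (p w)) * β - s' ∈ {x : ℂ | x ^ 2 + e = 0} :=
        fun w => by
      have h2 := congrArg conj (h1 w w.2)
      simpa using h2
    have hfin : {x : ℂ | x ^ 2 + e = 0}.Finite := by
      obtain ⟨r, hr⟩ := IsAlgClosed.exists_pow_nat_eq (-e) two_pos
      refine (Set.toFinite {r, -r}).subset fun x hx => ?_
      have h2 : x ^ 2 = r ^ 2 := by rw [hr]; exact eq_neg_of_add_eq_zero_left hx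
      exact sq_eq_sq_iff_eq_or_eq_neg.1 h2
    refine hinf ((hfin.preimage (f := fun x => x * β - s') (fun x _ y _ hxy => ?_)).subset ?_)
    · exact mul_right_cancel₀ hβ (sub_left_injective hxy)
    · rintro _ ⟨w, rfl⟩
      exact hconst w

/-- With m = P/p the second pencil is m X, where X = p + t q. Passing from X to m X adds S(m) -
(m'/m)(X'/X) to X''/X - (3/2)(X'/X)², where S(m) is the same expression in m. This correction must
vanish for every t, although X'/X depends on t. -/
theorem exists_eq_const_mul (hΩ : IsOpen Ω) (hc : IsPreconnected Ω)
    (hp : DifferentiableOn ℂ p Ω) (hq : DifferentiableOn ℂ q Ω) (hP : DifferentiableOn ℂ P Ω)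
    (hpq : ∀ z ∈ Ω, ‖q z‖ < ‖p z‖) (hP0 : ∀ z ∈ Ω, P z ≠ 0)
    {z₀ : ℂ} (hz₀ : z₀ ∈ Ω) (hq0 : q z₀ = 0) (hq1 : deriv q z₀ ≠ 0) {κ : ℂ} (hκ : ‖κ‖ = 1)
    (hQ : ∀ z ∈ Ω, Q z = κ * (P z / p z) * q z)
    (h : ∀ z ∈ Ω, ∀ w ∈ Ω, pencilSchwarzian p q (-(conj (q w) / conj (p w))) z =
      pencilSchwarzian P Q (-(conj (Q w) / conj (P w))) z) :
    ∃ c : ℂ, c ≠ 0 ∧ ∀ z ∈ Ω, P z = c * p z := by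
  have hp0 : ∀ z ∈ Ω, p z ≠ 0 := fun z hz => ne_zero_of_norm_lt (hpq z hz)
  set m : ℂ → ℂ := fun z => P z / p z with hm
  have hmd : DifferentiableOn ℂ m Ω := hP.div hp hp0
  have hκκ : conj κ * κ = 1 := by rw [mul_comm, Complex.mul_conj', hκ]; simp
  have hm0 : ∀ z ∈ Ω, m z ≠ 0 := fun z hz => div_ne_zero (hP0 z hz) (hp0 z hz)
  have hQd : DifferentiableOn ℂ Q Ω := ((hmd.const_mul κ).mul hq).congr hQ
  have hT : ∀ w ∈ Ω, -(conj (Q w) / conj (P w)) = conj κ * -(conj (q w) / conj (p w)) := by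
    intro w hw
    rw [hQ w hw]
    have h1 : conj (p w) ≠ 0 := by simpa using hp0 w hw
    have h2 : conj (P w) ≠ 0 := by simpa using hP0 w hw
    simp only [map_mul, map_div₀]
    field_simp
  have hpencil : ∀ t : ℂ, ∀ z ∈ Ω, P z + (conj κ * t) * Q z = m z * (p z + t * q z) := by
    intro t z hz
    rw [hQ z hz]
    have h1 : P z = m z * p z := by simp only [hm]; field_simp [hp0 z hz]
    change P z + conj κ * t * (κ * m z * q z) = _
    linear_combination h1 + (t * m z * q z) * hκκ
  have hd : ∀ t : ℂ, DifferentiableOn ℂ (fun w => p w + t * q w) Ω := fun t =>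
    hp.add (hq.const_mul t)
  have hprod : ∀ {a b : ℂ → ℂ}, DifferentiableOn ℂ a Ω → DifferentiableOn ℂ b Ω → ∀ z ∈ Ω,
      deriv (fun w => a w * b w) z = deriv a z * b z + a z * deriv b z := fun ha hb z hz =>
    ((ha.differentiableAt (hΩ.mem_nhds hz)).hasDerivAt.fun_mul
      (hb.differentiableAt (hΩ.mem_nhds hz)).hasDerivAt).deriv
  have hprod2 : ∀ {a b : ℂ → ℂ}, DifferentiableOn ℂ a Ω → DifferentiableOn ℂ b Ω → ∀ z ∈ Ω,
      deriv (deriv fun w => a w * b w) z =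
        deriv (deriv a) z * b z + 2 * deriv a z * deriv b z + a z * deriv (deriv b) z := by
    intro a b ha hb z hz
    have he : deriv (fun w => a w * b w) =ᶠ[𝓝 z] fun w => deriv a w * b w + a w * deriv b w := by
      filter_upwards [hΩ.mem_nhds hz] with w hw using hprod ha hb w hw
    have D : ∀ {r : ℂ → ℂ}, DifferentiableOn ℂ r Ω → HasDerivAt r (deriv r z) z := fun hr =>
      (hr.differentiableAt (hΩ.mem_nhds hz)).hasDerivAt
    rw [he.deriv_eq, (((D (ha.deriv hΩ)).fun_mul (D hb)).fun_add
      ((D ha).fun_mul (D (hb.deriv hΩ)))).deriv]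
    ring
  have key : ∀ z ∈ Ω, ∀ w ∈ Ω, deriv (deriv m) z / m z - 3 / 2 * (deriv m z / m z) ^ 2 -
      deriv m z / m z * ((deriv p z + -(conj (q w) / conj (p w)) * deriv q z) /
        (p z + -(conj (q w) / conj (p w)) * q z)) = 0 := by
    intro z hz w hw
    have h1 := h z hz w hw
    rw [hT w hw, pencilSchwarzian_eq hΩ hP hQd _ hz] at h1
    have hX0 : p z + -(conj (q w) / conj (p w)) * q z ≠ 0 := by
      have hpw : conj (p w) ≠ 0 := by simpa using hp0 w hw
      have h2 := mul_sub_mul_ne_zero (hpq z hz)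
        (show ‖conj (q w)‖ < ‖conj (p w)‖ by simpa using hpq w hw)
      intro h3
      apply h2
      field_simp at h3
      linear_combination h3
    generalize -(conj (q w) / conj (p w)) = t at h1 hX0 ⊢
    have he : (fun w => P w + (conj κ * t) * Q w) =ᶠ[𝓝 z] fun w => m w * (p w + t * q w) := by
      filter_upwards [hΩ.mem_nhds hz] with w hw using hpencil t w hw
    rw [he.deriv.deriv_eq, he.deriv_eq, hpencil t z hz, hprod hmd (hd t) z hz,
      hprod2 hmd (hd t) z hz, deriv_pencil hΩ hp hq t hz, deriv_deriv_pencil hΩ hp hq t hz,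
      pencilSchwarzian] at h1
    generalize p z + t * q z = X at h1 hX0 ⊢
    generalize deriv p z + t * deriv q z = X₁ at h1 ⊢
    generalize deriv (deriv p) z + t * deriv (deriv q) z = X₂ at h1 ⊢
    have hmz := hm0 z hz
    have h4 : (deriv (deriv m) z * X + 2 * deriv m z * X₁ + m z * X₂) / (m z * X) =
        deriv (deriv m) z / m z + 2 * (deriv m z / m z) * (X₁ / X) + X₂ / X := by field_simp
    have h5 : (deriv m z * X + m z * X₁) / (m z * X) = deriv m z / m z + X₁ / X := by field_simp
    rw [h4, h5] at h1
    linear_combination -h1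
  obtain ⟨w, hw, hqw⟩ : ∃ w ∈ Ω, q w ≠ 0 := by
    by_contra! hall
    refine hq1 ?_
    have hev : q =ᶠ[𝓝 z₀] fun _ => 0 := by
      filter_upwards [hΩ.mem_nhds hz₀] with w hw using hall w hw
    rw [hev.deriv_eq, deriv_const]
  -- Difference of `key` at t = 0 (the point z₀) and at a nonzero t. The second factor is p q' ≠ 0
  -- at z₀, so m' vanishes identically.
  have hprod0 : ∀ z ∈ Ω, deriv m z * (p z * deriv q z - deriv p z * q z) = 0 := by
    intro z hz
    have h1 := key z hz z₀ hz₀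
    have h2 := key z hz w hw
    have hpw : conj (p w) ≠ 0 := by simpa using hp0 w hw
    have hX0 : p z + -(conj (q w) / conj (p w)) * q z ≠ 0 := by
      have h2 := mul_sub_mul_ne_zero (hpq z hz)
        (show ‖conj (q w)‖ < ‖conj (p w)‖ by simpa using hpq w hw)
      intro h3
      apply h2
      field_simp at h3
      linear_combination h3
    have ht : -(conj (q w) / conj (p w)) ≠ 0 :=
      neg_ne_zero.2 (div_ne_zero (by simpa using hqw) hpw)
    simp only [hq0, map_zero, zero_div, neg_zero, zero_mul, add_zero] at h1
    generalize -(conj (q w) / conj (p w)) = t at h2 hX0 ht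
    have hmz := hm0 z hz
    have hpz := hp0 z hz
    have h3 : deriv m z / m z * ((deriv p z + t * deriv q z) / (p z + t * q z)) =
        deriv m z / m z * (deriv p z / p z) := by linear_combination h1 - h2
    field_simp at h3
    refine (mul_eq_zero.1 (?_ : t * _ = 0)).resolve_left ht
    linear_combination h3
  have hm1 : ∀ z ∈ Ω, deriv m z = 0 := by
    have hp1 := hp.deriv hΩ
    have hq1' := hq.deriv hΩ
    rcases AnalyticOnNhd.eq_zero_or_eq_zero_of_mul_eq_zero
      ((hmd.deriv hΩ).analyticOnNhd hΩ)
      (DifferentiableOn.analyticOnNhd ((hp.mul hq1').sub (hp1.mul hq)) hΩ) hprod0 hc with h1 | h1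
    · exact h1
    · have h2 := h1 z₀ hz₀
      simp only [Pi.sub_apply, Pi.mul_apply, hq0, mul_zero, sub_zero] at h2
      exact absurd h2 (mul_ne_zero (hp0 z₀ hz₀) hq1)
  refine ⟨m z₀, hm0 z₀ hz₀, fun z hz => ?_⟩
  rw [← hΩ.is_const_of_deriv_eq_zero hc hmd (fun w hw => hm1 w hw) hz hz₀]
  simp only [hm]
  field_simp [hp0 z hz]

/-- Rigidity for normalized pairs: equality of the Schwarzian derivatives of `conj g + h` and
`conj G + H`, with derivatives `q = g'`, `p = h'`, `Q = G'`, `P = H'`. -/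
theorem rigidity_of_normalized (hΩ : IsOpen Ω) (hc : IsPreconnected Ω)
    (hp : DifferentiableOn ℂ p Ω) (hq : DifferentiableOn ℂ q Ω)
    (hP : DifferentiableOn ℂ P Ω) (hQ : DifferentiableOn ℂ Q Ω)
    (hpq : ∀ z ∈ Ω, ‖q z‖ < ‖p z‖) (hPQ : ∀ z ∈ Ω, ‖Q z‖ < ‖P z‖)
    {z₀ : ℂ} (hz₀ : z₀ ∈ Ω) (hq0 : q z₀ = 0) (hQ0 : Q z₀ = 0) (hq1 : deriv q z₀ ≠ 0)
    (h : ∀ z ∈ Ω, schwarzianKernel p q z (conj (p z)) (conj (q z)) =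
      schwarzianKernel P Q z (conj (P z)) (conj (Q z))) :
    ∃ c κ : ℂ, c ≠ 0 ∧ ‖κ‖ = 1 ∧ ∀ z ∈ Ω, P z = c * p z ∧ Q z = κ * c * q z := by
  have hp0 : ∀ z ∈ Ω, p z ≠ 0 := fun z hz => ne_zero_of_norm_lt (hpq z hz)
  have hP0 : ∀ z ∈ Ω, P z ≠ 0 := fun z hz => ne_zero_of_norm_lt (hPQ z hz)
  have h1 : ∀ z ∈ Ω, ∀ w ∈ Ω, pencilSchwarzian p q (-(conj (q w) / conj (p w))) z =
      pencilSchwarzian P Q (-(conj (Q w) / conj (P w))) z := fun z hz w hw => by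
    rw [← schwarzianKernel_eq_pencilSchwarzian _ _ _ _ (by simpa using hp0 w hw),
      ← schwarzianKernel_eq_pencilSchwarzian _ _ _ _ (by simpa using hP0 w hw)]
    exact schwarzianKernel_eq_of_diagonal hΩ hc hp hq hP hQ hpq hPQ h z hz w hw
  obtain ⟨κ, hκ, hrel⟩ := exists_dilatation_eq hΩ hc hp hq hP hQ hp0 hP0 hz₀ hq0 hQ0 hq1 h1
  have hQ' : ∀ z ∈ Ω, Q z = κ * (P z / p z) * q z := fun z hz => by
    have h2 := hrel z hz
    have := hp0 z hz
    have := hP0 z hz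
    field_simp at h2 ⊢
    linear_combination h2
  obtain ⟨c, hc0, hcP⟩ := exists_eq_const_mul hΩ hc hp hq hP hpq hP0 hz₀ hq0 hq1 hκ hQ' h1
  refine ⟨c, κ, hc0, hκ, fun z hz => ⟨hcP z hz, ?_⟩⟩
  have := hp0 z hz
  rw [hQ' z hz, hcP z hz]
  field_simp

end

/-! ### Analytic maps with equal Schwarzian derivatives. -/

section

variable {Ω : Set ℂ} {h k : ℂ → ℂ}

/-- On a simply connected set, `-2 y' / y = p' / p` has a solution without zeros. -/
theorem exists_sqrt_inv_of_ne_zero (hΩ : IsOpen Ω) (hsc : IsSimplyConnected Ω) {p : ℂ → ℂ}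
    (hp : DifferentiableOn ℂ p Ω) (hp0 : ∀ z ∈ Ω, p z ≠ 0) :
    ∃ u : ℂ → ℂ, (∀ z, u z ≠ 0) ∧ ∀ z ∈ Ω,
      HasDerivAt u (-(deriv p z / (2 * p z)) * u z) z ∧
      HasDerivAt (fun z => -(deriv p z / (2 * p z)) * u z)
        (-(deriv (deriv p) z / p z - 3 / 2 * (deriv p z / p z) ^ 2) / 2 * u z) z := by
  have hp1 := hp.deriv hΩ
  obtain ⟨a, ha⟩ := exists_primitive hΩ hsc (p := fun z => -(deriv p z / (2 * p z)))
    ((hp1.div (hp.const_mul 2) fun z hz => mul_ne_zero two_ne_zero (hp0 z hz)).neg)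
  -- This is p^(-1/2) up to a constant factor; it solves y'' + (S/2) y = 0, with S = p''/p -
  -- (3/2)(p'/p)².
  refine ⟨fun z => Complex.exp (a z), fun z => Complex.exp_ne_zero _, fun z hz => ?_⟩
  have h1 : HasDerivAt (fun z => Complex.exp (a z))
      (-(deriv p z / (2 * p z)) * Complex.exp (a z)) z := by
    simpa only [mul_comm] using (ha z hz).cexp
  refine ⟨h1, ?_⟩
  have hpz := hp0 z hz
  have d0 := (hp.differentiableAt (hΩ.mem_nhds hz)).hasDerivAt
  have d1 := (hp1.differentiableAt (hΩ.mem_nhds hz)).hasDerivAt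
  have h2 := ((d1.fun_div (d0.const_mul 2) (mul_ne_zero two_ne_zero hpz)).fun_neg).fun_mul h1
  refine h2.congr_deriv ?_
  field_simp
  ring

/-- Two holomorphic maps with the same Schwarzian derivative differ by a Möbius
transformation. -/
theorem isMobiusPostcomp_of_schwarzian_eq (hΩ : IsOpen Ω) (hsc : IsSimplyConnected Ω)
    (hh : DifferentiableOn ℂ h Ω) (hk : DifferentiableOn ℂ k Ω) (hh0 : ∀ z ∈ Ω, deriv h z ≠ 0)
    (hk0 : ∀ z ∈ Ω, deriv k z ≠ 0)
    (hS : ∀ z ∈ Ω, deriv (deriv (deriv k)) z / deriv k z -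
        3 / 2 * (deriv (deriv k) z / deriv k z) ^ 2 =
      deriv (deriv (deriv h)) z / deriv h z - 3 / 2 * (deriv (deriv h) z / deriv h z) ^ 2) :
    IsMobiusPostcomp Ω h k := by
  obtain ⟨z₀, hz₀⟩ := hsc.nonempty
  have hc : IsPreconnected Ω := hsc.isPathConnected.isConnected.isPreconnected
  have hconst : ∀ φ : ℂ → ℂ, (∀ z ∈ Ω, HasDerivAt φ 0 z) → ∀ z ∈ Ω, φ z = φ z₀ :=
    fun φ hφ z hz => hΩ.is_const_of_deriv_eq_zero hc
      (fun w hw => (hφ w hw).differentiableAt.differentiableWithinAt)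
      (fun w hw => (hφ w hw).deriv) hz hz₀
  obtain ⟨u, hu0, hu⟩ := exists_sqrt_inv_of_ne_zero hΩ hsc (hh.deriv hΩ) hh0
  obtain ⟨v, hv0, hv⟩ := exists_sqrt_inv_of_ne_zero hΩ hsc (hk.deriv hΩ) hk0
  have dh : ∀ z ∈ Ω, HasDerivAt h (deriv h z) z := fun z hz =>
    (hh.differentiableAt (hΩ.mem_nhds hz)).hasDerivAt
  have dk : ∀ z ∈ Ω, HasDerivAt k (deriv k z) z := fun z hz =>
    (hk.differentiableAt (hΩ.mem_nhds hz)).hasDerivAt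
  have dh1 : ∀ z ∈ Ω, HasDerivAt (deriv h) (deriv (deriv h) z) z := fun z hz =>
    ((hh.deriv hΩ).differentiableAt (hΩ.mem_nhds hz)).hasDerivAt
  have dk1 : ∀ z ∈ Ω, HasDerivAt (deriv k) (deriv (deriv k) z) z := fun z hz =>
    ((hk.deriv hΩ).differentiableAt (hΩ.mem_nhds hz)).hasDerivAt
  set u₁ : ℂ → ℂ := fun z => -(deriv (deriv h) z / (2 * deriv h z)) * u z with hu₁
  set v₁ : ℂ → ℂ := fun z => -(deriv (deriv k) z / (2 * deriv k z)) * v z with hv₁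
  -- Equivalent to (u h)'' = u'' h, so u h solves the same equation as u.
  have hu1 : ∀ z ∈ Ω, 2 * u₁ z * deriv h z + u z * deriv (deriv h) z = 0 := fun z hz => by
    have := hh0 z hz
    simp only [hu₁]
    field_simp
    ring
  have hv1 : ∀ z ∈ Ω, 2 * v₁ z * deriv k z + v z * deriv (deriv k) z = 0 := fun z hz => by
    have := hk0 z hz
    simp only [hv₁]
    field_simp
    ring
  have hv' : ∀ z ∈ Ω, HasDerivAt v₁ (-(deriv (deriv (deriv h)) z / deriv h z -
      3 / 2 * (deriv (deriv h) z / deriv h z) ^ 2) / 2 * v z) z := fun z hz => by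
    rw [← hS z hz]
    exact (hv z hz).2
  -- Since u, u h, v and k v solve one second-order equation, their mutual Wronskians are constant.
  -- By Cramer's rule these four Wronskians are the coefficients of the Möbius map.
  have hc1 := hconst (fun z => u z * v₁ z - u₁ z * v z) fun z hz => by
    refine (((hu z hz).1.fun_mul (hv' z hz)).fun_sub
      ((hu z hz).2.fun_mul (hv z hz).1)).congr_deriv ?_
    ring
  have hd1 := hconst (fun z => v z * (u₁ z * h z + u z * deriv h z) - v₁ z * (u z * h z))
    fun z hz => by
      refine (((hv z hz).1.fun_mul (((hu z hz).2.fun_mul (dh z hz)).fun_add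
        ((hu z hz).1.fun_mul (dh1 z hz)))).fun_sub
        ((hv' z hz).fun_mul ((hu z hz).1.fun_mul (dh z hz)))).congr_deriv ?_
      linear_combination v z * hu1 z hz
  have ha1 := hconst (fun z => u z * (deriv k z * v z + k z * v₁ z) - u₁ z * (k z * v z))
    fun z hz => by
      refine (((hu z hz).1.fun_mul (((dk1 z hz).fun_mul (hv z hz).1).fun_add
        ((dk z hz).fun_mul (hv' z hz)))).fun_sub
        ((hu z hz).2.fun_mul ((dk z hz).fun_mul (hv z hz).1))).congr_deriv ?_
      linear_combination u z * hv1 z hz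
  have hb1 := hconst (fun z => k z * v z * (u₁ z * h z + u z * deriv h z) -
    (deriv k z * v z + k z * v₁ z) * (u z * h z)) fun z hz => by
      refine ((((dk z hz).fun_mul (hv z hz).1).fun_mul (((hu z hz).2.fun_mul (dh z hz)).fun_add
        ((hu z hz).1.fun_mul (dh1 z hz)))).fun_sub
        ((((dk1 z hz).fun_mul (hv z hz).1).fun_add ((dk z hz).fun_mul (hv' z hz))).fun_mul
          ((hu z hz).1.fun_mul (dh z hz)))).congr_deriv ?_
      linear_combination (k z * v z) * hu1 z hz - (u z * h z) * hv1 z hz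
  refine ⟨u z₀ * (deriv k z₀ * v z₀ + k z₀ * v₁ z₀) - u₁ z₀ * (k z₀ * v z₀),
    k z₀ * v z₀ * (u₁ z₀ * h z₀ + u z₀ * deriv h z₀) -
      (deriv k z₀ * v z₀ + k z₀ * v₁ z₀) * (u z₀ * h z₀),
    u z₀ * v₁ z₀ - u₁ z₀ * v z₀,
    v z₀ * (u₁ z₀ * h z₀ + u z₀ * deriv h z₀) - v₁ z₀ * (u z₀ * h z₀), ?_, fun z hz => ?_⟩
  -- The determinant is the product of the Wronskians of (u, u h) and (v, k v).
  · have hne : u z₀ ^ 2 * deriv h z₀ * (v z₀ ^ 2 * deriv k z₀) ≠ 0 :=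
      mul_ne_zero (mul_ne_zero (pow_ne_zero 2 (hu0 _)) (hh0 _ hz₀))
        (mul_ne_zero (pow_ne_zero 2 (hv0 _)) (hk0 _ hz₀))
    intro h0
    apply hne
    rw [← h0]
    ring
  · rw [← ha1 z hz, ← hb1 z hz, ← hc1 z hz, ← hd1 z hz]
    have hden : (u z * v₁ z - u₁ z * v z) * h z +
        (v z * (u₁ z * h z + u z * deriv h z) - v₁ z * (u z * h z)) =
        u z * v z * deriv h z := by ring
    have hne : u z * v z * deriv h z ≠ 0 := mul_ne_zero (mul_ne_zero (hu0 z) (hv0 z)) (hh0 z hz)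
    rw [hden]
    refine ⟨hne, ?_⟩
    rw [eq_div_iff hne]
    ring

/-- Möbius transformations preserve local univalence and the Schwarzian derivative of
holomorphic maps. -/
theorem IsMobiusPostcomp.schwarzian_eq (hΩ : IsOpen Ω) (hh : DifferentiableOn ℂ h Ω)
    (hh0 : ∀ z ∈ Ω, deriv h z ≠ 0) (hm : IsMobiusPostcomp Ω h k) :
    DifferentiableOn ℂ k Ω ∧ ∀ z ∈ Ω, deriv k z ≠ 0 ∧
      deriv (deriv (deriv k)) z / deriv k z - 3 / 2 * (deriv (deriv k) z / deriv k z) ^ 2 =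
        deriv (deriv (deriv h)) z / deriv h z -
          3 / 2 * (deriv (deriv h) z / deriv h z) ^ 2 := by
  obtain ⟨a, b, c, d, hdet, hm⟩ := hm
  have hh1 := hh.deriv hΩ
  have hh2 := hh1.deriv hΩ
  have D : ∀ {r : ℂ → ℂ}, DifferentiableOn ℂ r Ω → ∀ {z}, z ∈ Ω → HasDerivAt r (deriv r z) z :=
    fun hr _ hz => (hr.differentiableAt (hΩ.mem_nhds hz)).hasDerivAt
  have De : ∀ {z}, z ∈ Ω → HasDerivAt (fun z => c * h z + d) (c * deriv h z) z := fun hz =>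
    ((D hh hz).const_mul c).add_const d
  have k1 : ∀ z ∈ Ω, HasDerivAt k ((a * d - b * c) * deriv h z / (c * h z + d) ^ 2) z := by
    intro z hz
    have hne := (hm z hz).1
    have h1 := (((D hh hz).const_mul a).add_const b).fun_div (De hz) hne
    refine (h1.congr_of_eventuallyEq ?_).congr_deriv ?_
    · filter_upwards [hΩ.mem_nhds hz] with w hw using (hm w hw).2
    · field_simp
      ring
  have k2 : ∀ z ∈ Ω, HasDerivAt (deriv k) ((a * d - b * c) *
      (deriv (deriv h) z * (c * h z + d) - 2 * c * deriv h z ^ 2) / (c * h z + d) ^ 3) z := by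
    intro z hz
    have hne := (hm z hz).1
    have h1 := ((D hh1 hz).const_mul (a * d - b * c)).fun_div ((De hz).fun_pow 2)
      (pow_ne_zero 2 hne)
    refine (h1.congr_of_eventuallyEq ?_).congr_deriv ?_
    · filter_upwards [hΩ.mem_nhds hz] with w hw using (k1 w hw).deriv
    · simp only [Nat.add_one_sub_one, pow_one, Nat.cast_ofNat]
      field_simp
  have k3 : ∀ z ∈ Ω, HasDerivAt (deriv (deriv k)) ((a * d - b * c) *
      (deriv (deriv (deriv h)) z * (c * h z + d) ^ 2 -
        6 * c * deriv h z * deriv (deriv h) z * (c * h z + d) +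
        6 * c ^ 2 * deriv h z ^ 3) / (c * h z + d) ^ 4) z := by
    intro z hz
    have hne := (hm z hz).1
    have h1 := ((((D hh2 hz).fun_mul (De hz)).fun_sub
      (((D hh1 hz).fun_pow 2).const_mul (2 * c))).const_mul (a * d - b * c)).fun_div
      ((De hz).fun_pow 3) (pow_ne_zero 3 hne)
    refine (h1.congr_of_eventuallyEq ?_).congr_deriv ?_
    · filter_upwards [hΩ.mem_nhds hz] with w hw using (k2 w hw).deriv
    · simp only [Nat.add_one_sub_one, pow_one, Nat.cast_ofNat]
      field_simp
      ring
  refine ⟨fun z hz => (k1 z hz).differentiableAt.differentiableWithinAt, fun z hz => ?_⟩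
  have hne := (hm z hz).1
  have hhz := hh0 z hz
  rw [(k1 z hz).deriv, (k2 z hz).deriv, (k3 z hz).deriv]
  refine ⟨div_ne_zero (mul_ne_zero hdet hhz) (pow_ne_zero 2 hne), ?_⟩
  field_simp
  ring

end

/-! ### Affine transformations and anti-analytic rotations. -/

section

variable {Ω : Set ℂ} {f F G : ℂ → ℂ}

theorem norm_ne_norm_iff {a b : ℂ} : ‖a‖ ≠ ‖b‖ ↔ b * conj b - a * conj a ≠ 0 := by
  rw [Complex.mul_conj', Complex.mul_conj', not_iff_not, sub_eq_zero]
  constructor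
  · intro h
    rw [h]
  · intro h
    exact ((sq_eq_sq₀ (norm_nonneg _) (norm_nonneg _)).1 (by exact_mod_cast h)).symm

theorem IsAffinePostcomp.trans (h₁ : IsAffinePostcomp Ω f G) (h₂ : IsAffinePostcomp Ω G F) :
    IsAffinePostcomp Ω f F := by
  obtain ⟨a₁, b₁, c₁, hab₁, h₁⟩ := h₁
  obtain ⟨a₂, b₂, c₂, hab₂, h₂⟩ := h₂
  refine ⟨a₂ * conj b₁ + b₂ * a₁, a₂ * conj a₁ + b₂ * b₁, a₂ * conj c₁ + b₂ * c₁ + c₂, ?_,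
    fun z hz => ?_⟩
  · rw [norm_ne_norm_iff] at hab₁ hab₂ ⊢
    convert! mul_ne_zero hab₁ hab₂ using 1
    simp only [map_add, map_mul, Complex.conj_conj]
    ring
  · rw [h₂ z hz, h₁ z hz]
    simp only [map_add, map_mul, Complex.conj_conj]
    ring

/-- Affine maps `a conj ζ + b ζ + c` with `|a| ≠ |b|` are invertible. -/
theorem exists_affine_inverse {a b : ℂ} (hab : ‖a‖ ≠ ‖b‖) (c : ℂ) :
    ∃ a' b' c' : ℂ, ‖a'‖ ≠ ‖b'‖ ∧ a * conj a' + b * b' = 1 ∧ a * conj b' + b * a' = 0 ∧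
      ∀ x y : ℂ, y = a * conj x + b * x + c → x = a' * conj y + b' * y + c' := by
  rw [norm_ne_norm_iff] at hab
  set Δ := b * conj b - a * conj a with hΔ
  have hΔc : conj Δ = Δ := by simp [hΔ, mul_comm]
  have hdef : b * conj b - a * conj a = Δ := rfl
  refine ⟨-a / Δ, conj b / Δ, (a * conj c - conj b * c) / Δ, ?_, ?_, ?_, ?_⟩
  · rw [norm_ne_norm_iff]
    simp only [map_div₀, map_neg, Complex.conj_conj, hΔc]
    have h : conj b / Δ * (b / Δ) - -a / Δ * (-conj a / Δ) = 1 / Δ := by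
      field_simp
      linear_combination hdef
    rw [h]
    exact one_div_ne_zero hab
  · simp only [map_div₀, map_neg, hΔc]
    field_simp
    linear_combination hdef
  · simp only [map_div₀, Complex.conj_conj, hΔc]
    field_simp
    ring
  · rintro x y rfl
    simp only [map_add, map_mul, Complex.conj_conj]
    field_simp
    linear_combination (-x) * hdef

theorem IsAffinePostcomp.symm (h : IsAffinePostcomp Ω f F) : IsAffinePostcomp Ω F f := by
  obtain ⟨a, b, c, hab, h⟩ := h
  obtain ⟨a', b', c', hab', -, -, h'⟩ := exists_affine_inverse hab c
  exact ⟨a', b', c', hab', fun z hz => h' _ _ (h z hz)⟩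

/-- A rotation of an affine image of `f` is an affine image of a rotation of `f`. -/
theorem IsAffinePostcomp.exists_rotation_comm {f' : ℂ → ℂ} (h : IsAffinePostcomp Ω f f')
    (hG : IsAntiAnalyticRotation Ω f' G) :
    ∃ R, IsAntiAnalyticRotation Ω f R ∧ IsAffinePostcomp Ω R G := by
  obtain ⟨a, b, c, hab, h⟩ := h
  obtain ⟨g₁, h₁, hg₁, hh₁, hf', μ, hμ, hG⟩ := hG
  obtain ⟨a', b', c', -, e1, e2, h'⟩ := exists_affine_inverse hab c
  have hμμ : μ * conj μ = 1 := by rw [Complex.mul_conj', hμ]; simp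
  have e1c : conj a * a' + conj b * conj b' = 1 := by simpa using congrArg conj e1
  refine ⟨fun z => μ * conj (conj a' * h₁ z + conj b' * g₁ z) + (a' * g₁ z + b' * h₁ z + c'),
    ⟨fun z => conj a' * h₁ z + conj b' * g₁ z, fun z => a' * g₁ z + b' * h₁ z + c',
      by fun_prop, by fun_prop, fun z hz => ?_, μ, hμ, fun z _ => rfl⟩,
    -- When conj g is rotated by μ, the coefficient a μ keeps the analytic part a g + b h unchanged
    -- and multiplies the anti-analytic part a conj h + b conj g by μ.
    ⟨a * μ, b, -(a * μ * conj c' + b * c'), by rwa [norm_mul, hμ, mul_one], fun z hz => ?_⟩⟩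
  · rw [h' _ _ (h z hz), hf' z hz]
    simp only [map_add, map_mul, Complex.conj_conj]
    ring
  · rw [hG z hz]
    simp only [map_add, map_mul, Complex.conj_conj]
    linear_combination (-μ * conj (g₁ z) - h₁ z) * e1 -
      (g₁ z + μ * conj (h₁ z)) * e2 +
      (-(a * conj a') * h₁ z - a * conj b' * g₁ z) * hμμ

namespace Decomposition

variable {g h : ℂ → ℂ}

theorem affine (D : Decomposition Ω f g h) {a b c : ℂ}
    (hF : ∀ z ∈ Ω, F z = a * conj (f z) + b * f z + c) :
    Decomposition Ω F (fun z => conj a * h z + conj b * g z) (fun z => a * g z + b * h z + c) where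
  isOpen := D.isOpen
  left := (D.right.const_mul _).add (D.left.const_mul _)
  right := ((D.left.const_mul _).add (D.right.const_mul _)).add_const _
  eq z hz := by
    rw [hF z hz, D.eq z hz]
    simp only [map_add, map_mul, Complex.conj_conj]
    ring

theorem deriv_affine_left (D : Decomposition Ω f g h) (a b : ℂ) {z : ℂ} (hz : z ∈ Ω) :
    deriv (fun z => a * h z + b * g z) z = a * deriv h z + b * deriv g z :=
  (((D.right.differentiableAt (D.isOpen.mem_nhds hz)).hasDerivAt.const_mul a).fun_add
    ((D.left.differentiableAt (D.isOpen.mem_nhds hz)).hasDerivAt.const_mul b)).deriv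

theorem deriv_affine_right (D : Decomposition Ω f g h) (a b c : ℂ) {z : ℂ} (hz : z ∈ Ω) :
    deriv (fun z => a * g z + b * h z + c) z = a * deriv g z + b * deriv h z :=
  ((((D.left.differentiableAt (D.isOpen.mem_nhds hz)).hasDerivAt.const_mul a).fun_add
    ((D.right.differentiableAt (D.isOpen.mem_nhds hz)).hasDerivAt.const_mul b)).add_const c).deriv

theorem jacobian_affine (D : Decomposition Ω f g h) {a b c : ℂ}
    (hF : ∀ z ∈ Ω, F z = a * conj (f z) + b * f z + c) {z : ℂ} (hz : z ∈ Ω) :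
    jacobian F z = (‖b‖ ^ 2 - ‖a‖ ^ 2) * jacobian f z := by
  have h1 : (jacobian F z : ℂ) = ((‖b‖ ^ 2 - ‖a‖ ^ 2) * jacobian f z : ℝ) := by
    push_cast
    rw [(D.affine hF).ofReal_jacobian_eq hz, D.ofReal_jacobian_eq hz, D.deriv_affine_left _ _ hz,
      D.deriv_affine_right _ _ _ hz, ← Complex.mul_conj', ← Complex.mul_conj']
    simp only [map_add, map_mul, Complex.conj_conj]
    ring
  exact_mod_cast h1

theorem rotation (D : Decomposition Ω f g h) {μ : ℂ} (hF : ∀ z ∈ Ω, F z = μ * conj (g z) + h z) :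
    Decomposition Ω F (fun z => conj μ * g z) h where
  isOpen := D.isOpen
  left := D.left.const_mul _
  right := D.right
  eq z hz := by simp [hF z hz]

theorem jacobian_rotation (D : Decomposition Ω f g h) {μ : ℂ} (hμ : ‖μ‖ = 1)
    (hF : ∀ z ∈ Ω, F z = μ * conj (g z) + h z) {z : ℂ} (hz : z ∈ Ω) :
    jacobian F z = jacobian f z := by
  rw [(D.rotation hF).jacobian_eq hz, D.jacobian_eq hz,
    ((D.left.differentiableAt (D.isOpen.mem_nhds hz)).hasDerivAt.const_mul (conj μ)).deriv]
  simp [hμ]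

end Decomposition

theorem exists_decomposition_of_isLocallyUnivalentHarmonic (hΩ : IsOpen Ω)
    (hsc : IsSimplyConnected Ω) (hf : IsLocallyUnivalentHarmonic Ω f) :
    ∃ g h, Decomposition Ω f g h :=
  let ⟨g, h, hg, hh, he⟩ := exists_decomposition hΩ hsc hf.1
  ⟨g, h, hΩ, hg, hh, he⟩

theorem dz_const_add (c : ℂ) (φ : ℂ → ℂ) (z : ℂ) : dz (fun w => c + φ w) z = dz φ z := by
  rw [dz, dz, fderiv_const_add]

/-- Proportional Jacobians have the same harmonic Schwarzian derivative. -/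
theorem schwarzian_eqOn_of_jacobian (hΩ : IsOpen Ω) {κ : ℝ} (hκ : κ ≠ 0)
    (hJ : ∀ z ∈ Ω, jacobian f z ≠ 0) (h : ∀ z ∈ Ω, jacobian F z = κ * jacobian f z) :
    EqOn (schwarzian F) (schwarzian f) Ω := by
  have hP : ∀ z ∈ Ω, preSchwarzian F z = preSchwarzian f z := by
    intro z hz
    have he : (fun w => ((Real.log |jacobian F w| : ℝ) : ℂ)) =ᶠ[𝓝 z]
        fun w => ((Real.log |κ| : ℝ) : ℂ) + ((Real.log |jacobian f w| : ℝ) : ℂ) := by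
      filter_upwards [hΩ.mem_nhds hz] with w hw
      rw [h w hw, abs_mul, Real.log_mul (abs_ne_zero.2 hκ) (abs_ne_zero.2 (hJ w hw))]
      push_cast
      rfl
    rw [preSchwarzian, dz_congr he, dz_const_add]
    rfl
  intro z hz
  have he : preSchwarzian F =ᶠ[𝓝 z] preSchwarzian f := by
    filter_upwards [hΩ.mem_nhds hz] with w hw using hP w hw
  rw [schwarzian, schwarzian, dz_congr he, hP z hz]

theorem Decomposition.isLocallyUnivalentHarmonic_of_jacobian {g h G H : ℂ → ℂ}
    (D : Decomposition Ω f g h) (D' : Decomposition Ω F G H) {κ : ℝ} (hκ : κ ≠ 0)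
    (hf : IsLocallyUnivalentHarmonic Ω f) (hJ : ∀ z ∈ Ω, jacobian F z = κ * jacobian f z) :
    IsLocallyUnivalentHarmonic Ω F ∧ EqOn (schwarzian F) (schwarzian f) Ω := by
  have h0 := D.isLocallyUnivalentHarmonic_iff.1 hf
  refine ⟨D'.isLocallyUnivalentHarmonic_iff.2 fun z hz => ?_,
    schwarzian_eqOn_of_jacobian D.isOpen hκ h0 hJ⟩
  rw [hJ z hz]
  exact mul_ne_zero hκ (h0 z hz)

theorem sq_sub_sq_ne_zero_of_norm_ne {a b : ℂ} (h : ‖a‖ ≠ ‖b‖) : ‖b‖ ^ 2 - ‖a‖ ^ 2 ≠ 0 :=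
  sub_ne_zero.2 fun h1 => h ((sq_eq_sq₀ (norm_nonneg _) (norm_nonneg _)).1 h1).symm

/-- Affine transformations and anti-analytic rotations preserve local univalence and the
harmonic Schwarzian derivative. -/
theorem schwarzian_eqOn_of_affine_or_rotation (hΩ : IsOpen Ω) (hsc : IsSimplyConnected Ω)
    (hf : IsLocallyUnivalentHarmonic Ω f)
    (h : IsAffinePostcomp Ω f F ∨ IsAntiAnalyticRotation Ω f F) :
    IsLocallyUnivalentHarmonic Ω F ∧ EqOn (schwarzian F) (schwarzian f) Ω := by
  rcases h with ⟨a, b, c, hab, hF⟩ | ⟨g, h, hg, hh, he, μ, hμ, hF⟩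
  · obtain ⟨g, h, D⟩ := exists_decomposition_of_isLocallyUnivalentHarmonic hΩ hsc hf
    exact D.isLocallyUnivalentHarmonic_of_jacobian (D.affine hF) (sq_sub_sq_ne_zero_of_norm_ne hab)
      hf fun z hz => D.jacobian_affine hF hz
  · have D : Decomposition Ω f g h := ⟨hΩ, hg, hh, he⟩
    exact D.isLocallyUnivalentHarmonic_of_jacobian (D.rotation hF) one_ne_zero hf fun z hz => by
      rw [one_mul, D.jacobian_rotation hμ hF hz]

end

/-! ### Normalization, and rigidity for general maps. -/

section

variable {Ω : Set ℂ} {f F g h G H : ℂ → ℂ}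

theorem exists_eq_const_mul_add_of_deriv (hΩ : IsOpen Ω) (hc : IsPreconnected Ω)
    (hg : DifferentiableOn ℂ g Ω) (hh : DifferentiableOn ℂ h Ω) {c : ℂ}
    (hd : ∀ z ∈ Ω, deriv g z = c * deriv h z) : ∃ k, ∀ z ∈ Ω, g z = c * h z + k := by
  rcases Ω.eq_empty_or_nonempty with rfl | ⟨z₀, hz₀⟩
  · exact ⟨0, by simp⟩
  have h1 : ∀ z ∈ Ω, HasDerivAt (fun z => g z - c * h z) 0 z := fun z hz => by
    refine (((hg.differentiableAt (hΩ.mem_nhds hz)).hasDerivAt).fun_sub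
      ((hh.differentiableAt (hΩ.mem_nhds hz)).hasDerivAt.const_mul c)).congr_deriv ?_
    rw [hd z hz, sub_self]
  refine ⟨g z₀ - c * h z₀, fun z hz => ?_⟩
  have h2 := hΩ.is_const_of_deriv_eq_zero hc
    (fun w hw => (h1 w hw).differentiableAt.differentiableWithinAt)
    (fun w hw => (h1 w hw).deriv) hz hz₀
  linear_combination h2

namespace Decomposition

theorem norm_lt_or_norm_lt (D : Decomposition Ω f g h) (hc : IsPreconnected Ω)
    (hJ : ∀ z ∈ Ω, jacobian f z ≠ 0) :
    (∀ z ∈ Ω, ‖deriv g z‖ < ‖deriv h z‖) ∨ ∀ z ∈ Ω, ‖deriv h z‖ < ‖deriv g z‖ := by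
  have hne : ∀ z ∈ Ω, ‖deriv h z‖ - ‖deriv g z‖ ≠ 0 := fun z hz h0 => by
    apply hJ z hz
    rw [D.jacobian_eq hz, sub_eq_zero.1 h0, sub_self]
  have hcont : ContinuousOn (fun z => ‖deriv h z‖ - ‖deriv g z‖) Ω :=
    (D.right.deriv D.isOpen).continuousOn.norm.sub (D.left.deriv D.isOpen).continuousOn.norm
  by_contra! hcon
  obtain ⟨⟨z, hz, hz'⟩, w, hw, hw'⟩ := hcon
  obtain ⟨x, hx, hx0⟩ := hc.intermediate_value hz hw hcont
    (⟨sub_nonpos.2 hz', sub_nonneg.2 hw'⟩ : (0 : ℝ) ∈ Icc _ _)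
  exact hne x hx hx0

/-- The homogeneous relation treats the dilatation ∞ (t = 0) on the same footing as finite ones. -/
theorem hasConstantDilatation_iff (D : Decomposition Ω f g h) (hJ : ∀ z ∈ Ω, jacobian f z ≠ 0) :
    HasConstantDilatation Ω f ↔ ∃ s t : ℂ, (s ≠ 0 ∨ t ≠ 0) ∧
      ∀ z ∈ Ω, s * deriv h z + t * deriv g z = 0 := by
  have hdil : ∀ z ∈ Ω, dilatation f z =
      if deriv h z = 0 then OnePoint.infty else ((deriv g z / deriv h z : ℂ) : OnePoint ℂ) :=
    fun z hz => by
      rw [dilatation, D.dz_eq hz, D.dzbar_eq hz, Complex.conj_conj]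
  constructor
  · rintro ⟨c, hc⟩
    induction c using OnePoint.rec with
    | infty =>
      refine ⟨1, 0, Or.inl one_ne_zero, fun z hz => ?_⟩
      have h1 := hdil z hz
      rw [hc z hz] at h1
      by_cases h0 : deriv h z = 0
      · simp [h0]
      · rw [if_neg h0] at h1
        exact absurd h1 (OnePoint.infty_ne_coe _)
    | coe c =>
      refine ⟨-c, 1, Or.inr one_ne_zero, fun z hz => ?_⟩
      have h1 := hdil z hz
      rw [hc z hz] at h1
      by_cases h0 : deriv h z = 0
      · rw [if_pos h0] at h1
        exact absurd h1 (OnePoint.coe_ne_infty _)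
      · rw [if_neg h0, OnePoint.coe_eq_coe] at h1
        rw [h1]
        field_simp
        ring
  · rintro ⟨s, t, hst, hrel⟩
    by_cases ht : t = 0
    · subst ht
      have hs : s ≠ 0 := by simpa using hst
      refine ⟨OnePoint.infty, fun z hz => ?_⟩
      have h0 : deriv h z = 0 := by simpa [hs] using hrel z hz
      rw [hdil z hz, if_pos h0]
    · refine ⟨((-s / t : ℂ) : OnePoint ℂ), fun z hz => ?_⟩
      have h1 := hrel z hz
      have h0 : deriv h z ≠ 0 := fun h0 => by
        have hg0 : deriv g z = 0 := by simpa [h0, ht] using h1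
        exact hJ z hz (by rw [D.jacobian_eq hz, h0, hg0, sub_self])
      rw [hdil z hz, if_neg h0, OnePoint.coe_eq_coe, div_eq_div_iff h0 ht]
      linear_combination h1

/-- If the dilatation is not constant, its derivative does not vanish identically. -/
theorem exists_wronskian_ne_zero (D : Decomposition Ω f g h) (hc : IsPreconnected Ω)
    (hJ : ∀ z ∈ Ω, jacobian f z ≠ 0) (hf : ¬ HasConstantDilatation Ω f) :
    ∃ z ∈ Ω, deriv (deriv g) z * deriv h z - deriv g z * deriv (deriv h) z ≠ 0 := by
  by_contra! hW
  refine hf ((D.hasConstantDilatation_iff hJ).2 ?_)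
  have hp := D.right.deriv D.isOpen
  have hq := D.left.deriv D.isOpen
  have key : ∀ {a b : ℂ → ℂ}, DifferentiableOn ℂ a Ω → DifferentiableOn ℂ b Ω →
      (∀ z ∈ Ω, b z ≠ 0) → (∀ z ∈ Ω, deriv a z * b z - a z * deriv b z = 0) →
      ∃ c : ℂ, ∀ z ∈ Ω, -c * b z + 1 * a z = 0 := by
    intro a b ha hb hb0 hab
    rcases Ω.eq_empty_or_nonempty with rfl | ⟨z₀, hz₀⟩
    · exact ⟨0, by simp⟩
    refine ⟨a z₀ / b z₀, fun z hz => ?_⟩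
    have h1 : ∀ w ∈ Ω, deriv (fun w => a w / b w) w = 0 := fun w hw => by
      rw [((ha.differentiableAt (D.isOpen.mem_nhds hw)).hasDerivAt.fun_div
        (hb.differentiableAt (D.isOpen.mem_nhds hw)).hasDerivAt (hb0 w hw)).deriv, hab w hw,
        zero_div]
    have h2 := D.isOpen.is_const_of_deriv_eq_zero hc (ha.div hb hb0) h1 hz hz₀
    have h3 : a z / b z = a z₀ / b z₀ := h2
    rw [← h3]
    field_simp [hb0 z hz]
    ring
  rcases D.norm_lt_or_norm_lt hc hJ with hlt | hlt
  · obtain ⟨c, hc⟩ := key hq hp (fun z hz => ne_zero_of_norm_lt (hlt z hz)) hW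
    exact ⟨-c, 1, Or.inr one_ne_zero, hc⟩
  · obtain ⟨c, hc⟩ := key hp hq (fun z hz => ne_zero_of_norm_lt (hlt z hz))
      (fun z hz => by linear_combination -hW z hz)
    exact ⟨1, -c, Or.inl one_ne_zero, fun z hz => by linear_combination hc z hz⟩

theorem star (D : Decomposition Ω f g h) : Decomposition Ω (fun z => conj (f z)) h g where
  isOpen := D.isOpen
  left := D.right
  right := D.left
  eq z hz := by simp [D.eq z hz, add_comm]

/-- Up to complex conjugation a locally univalent harmonic map is sense-preserving. -/
theorem exists_sense_preserving (D : Decomposition Ω f g h) (hc : IsPreconnected Ω)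
    (hJ : ∀ z ∈ Ω, jacobian f z ≠ 0) :
    ∃ f₁ g₁ h₁, Decomposition Ω f₁ g₁ h₁ ∧ IsAffinePostcomp Ω f f₁ ∧
      (∀ z ∈ Ω, ‖deriv g₁ z‖ < ‖deriv h₁ z‖) ∧
      ∀ z, deriv (deriv g) z * deriv h z - deriv g z * deriv (deriv h) z ≠ 0 →
        deriv (deriv g₁) z * deriv h₁ z - deriv g₁ z * deriv (deriv h₁) z ≠ 0 := by
  rcases D.norm_lt_or_norm_lt hc hJ with hlt | hlt
  · exact ⟨f, g, h, D, ⟨0, 1, 0, by simp, by simp⟩, hlt, fun _ hz => hz⟩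
  · refine ⟨_, h, g, D.star, ⟨1, 0, 0, by simp, by simp⟩, hlt, fun z hz h0 => hz ?_⟩
    linear_combination -h0

/-- After an affine transformation the dilatation vanishes at a given point. -/
theorem exists_normalized (D : Decomposition Ω f g h)
    (hlt : ∀ z ∈ Ω, ‖deriv g z‖ < ‖deriv h z‖) {z₀ : ℂ} (hz₀ : z₀ ∈ Ω) :
    ∃ f₁ g₁ h₁, Decomposition Ω f₁ g₁ h₁ ∧ IsAffinePostcomp Ω f f₁ ∧
      (∀ z ∈ Ω, ‖deriv g₁ z‖ < ‖deriv h₁ z‖) ∧ deriv g₁ z₀ = 0 ∧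
      (deriv (deriv g) z₀ * deriv h z₀ - deriv g z₀ * deriv (deriv h) z₀ ≠ 0 →
        deriv (deriv g₁) z₀ ≠ 0) := by
  have hp0 : deriv h z₀ ≠ 0 := ne_zero_of_norm_lt (hlt z₀ hz₀)
  -- The map a conj f + f has anti-analytic part conj (conj a · h + g). This a makes the derivative
  -- of conj a · h + g vanish at z₀, and |a| < 1 preserves orientation.
  set a : ℂ := conj (-(deriv g z₀ / deriv h z₀)) with ha
  have hac : conj a = -(deriv g z₀ / deriv h z₀) := by rw [ha, Complex.conj_conj]
  have ha1 : ‖a‖ < 1 := by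
    rw [ha, RCLike.norm_conj, norm_neg, norm_div, div_lt_one (norm_pos_iff.2 hp0)]
    exact hlt z₀ hz₀
  have hF : ∀ z ∈ Ω, a * conj (f z) + f z = a * conj (f z) + 1 * f z + 0 := fun z _ => by ring
  have D₁ := D.affine (F := fun z => a * conj (f z) + f z) hF
  refine ⟨_, _, _, D₁, ⟨a, 1, 0, by simpa using ha1.ne, hF⟩, fun z hz => ?_, ?_, fun hW => ?_⟩
  · have h1 := D.jacobian_affine (F := fun z => a * conj (f z) + f z) hF hz
    rw [D₁.jacobian_eq hz, D.jacobian_eq hz] at h1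
    have h2 : 0 < (‖(1 : ℂ)‖ ^ 2 - ‖a‖ ^ 2) * (‖deriv h z‖ ^ 2 - ‖deriv g z‖ ^ 2) := by
      refine mul_pos (sub_pos.2 ?_) (sub_pos.2 ?_)
      · exact pow_lt_pow_left₀ (by simpa using ha1) (norm_nonneg _) two_ne_zero
      · exact pow_lt_pow_left₀ (hlt z hz) (norm_nonneg _) two_ne_zero
    rw [← h1] at h2
    exact lt_of_pow_lt_pow_left₀ 2 (norm_nonneg _) (sub_pos.1 h2)
  · rw [D.deriv_affine_left _ _ hz₀, hac, map_one]
    field_simp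
    ring
  · have he : deriv (fun z => conj a * h z + conj 1 * g z) =ᶠ[𝓝 z₀]
        fun z => conj a * deriv h z + conj 1 * deriv g z := by
      filter_upwards [D.isOpen.mem_nhds hz₀] with z hz using D.deriv_affine_left _ _ hz
    have D2 : Decomposition Ω (fun z => conj (deriv g z) + deriv h z) (deriv g) (deriv h) :=
      ⟨D.isOpen, D.left.deriv D.isOpen, D.right.deriv D.isOpen, fun _ _ => rfl⟩
    rw [he.deriv_eq, D2.deriv_affine_left _ _ hz₀, hac, map_one]
    intro h0
    apply hW
    field_simp at h0
    linear_combination h0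

/-- Rigidity for sense-preserving maps with non-constant dilatation. -/
theorem exists_rotation_affine_of_sense_preserving (hsc : IsSimplyConnected Ω)
    (D : Decomposition Ω f g h) (D' : Decomposition Ω F G H)
    (hlt : ∀ z ∈ Ω, ‖deriv g z‖ < ‖deriv h z‖) (hlt' : ∀ z ∈ Ω, ‖deriv G z‖ < ‖deriv H z‖)
    (hf : IsLocallyUnivalentHarmonic Ω f) (hF : IsLocallyUnivalentHarmonic Ω F)
    {z₀ : ℂ} (hz₀ : z₀ ∈ Ω)
    (hW : deriv (deriv g) z₀ * deriv h z₀ - deriv g z₀ * deriv (deriv h) z₀ ≠ 0)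
    (hS : EqOn (schwarzian F) (schwarzian f) Ω) :
    ∃ R, IsAntiAnalyticRotation Ω f R ∧ IsAffinePostcomp Ω R F := by
  have hΩ := D.isOpen
  have hc : IsPreconnected Ω := hsc.isPathConnected.isConnected.isPreconnected
  obtain ⟨f₁, g₁, h₁, D₁, haff, hlt₁, hg0, hg1⟩ := D.exists_normalized hlt hz₀
  obtain ⟨F₁, G₁, H₁, D₁', haff', hlt₁', hG0, -⟩ := D'.exists_normalized hlt' hz₀
  obtain ⟨hf₁, hS₁⟩ := schwarzian_eqOn_of_affine_or_rotation hΩ hsc hf (Or.inl haff)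
  obtain ⟨hF₁, hS₁'⟩ := schwarzian_eqOn_of_affine_or_rotation hΩ hsc hF (Or.inl haff')
  obtain ⟨c, κ, hc0, hκ, hrel⟩ := rigidity_of_normalized hΩ hc (D₁.right.deriv hΩ)
    (D₁.left.deriv hΩ) (D₁'.right.deriv hΩ) (D₁'.left.deriv hΩ) hlt₁ hlt₁' hz₀ hg0 hG0 (hg1 hW)
    (fun z hz => by
      rw [← D₁.schwarzian_eq (D₁.isLocallyUnivalentHarmonic_iff.1 hf₁) hz,
        ← D₁'.schwarzian_eq (D₁'.isLocallyUnivalentHarmonic_iff.1 hF₁) hz,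
        hS₁ hz, hS₁' hz, hS hz])
  obtain ⟨k₁, hk₁⟩ := exists_eq_const_mul_add_of_deriv hΩ hc D₁'.right D₁.right
    fun z hz => (hrel z hz).1
  obtain ⟨k₂, hk₂⟩ := exists_eq_const_mul_add_of_deriv hΩ hc D₁'.left D₁.left
    fun z hz => (hrel z hz).2
  -- Up to a constant F₁ = conj (κ c) conj g₁ + c h₁; taking out c leaves a unimodular coefficient.
  have hrot : IsAntiAnalyticRotation Ω f₁ fun z => conj (κ * c) / c * conj (g₁ z) + h₁ z := by
    refine ⟨g₁, h₁, D₁.left, D₁.right, D₁.eq, conj (κ * c) / c, ?_, fun z _ => rfl⟩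
    rw [norm_div, RCLike.norm_conj, norm_mul, hκ, one_mul, div_self (norm_ne_zero_iff.2 hc0)]
  have haff₁ : IsAffinePostcomp Ω (fun z => conj (κ * c) / c * conj (g₁ z) + h₁ z) F₁ := by
    refine ⟨0, c, conj k₂ + k₁, by simpa using (norm_ne_zero_iff.2 hc0).symm, fun z hz => ?_⟩
    rw [D₁'.eq z hz, hk₁ z hz, hk₂ z hz]
    simp only [map_add, map_mul]
    field_simp
    ring
  obtain ⟨R, hR, hRaff⟩ := haff.exists_rotation_comm hrot
  exact ⟨R, hR, (hRaff.trans haff₁).trans haff'.symm⟩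

end Decomposition

/-- Rigidity for maps with non-constant dilatation. -/
theorem exists_rotation_affine (hΩ : IsOpen Ω) (hsc : IsSimplyConnected Ω)
    (hf : IsLocallyUnivalentHarmonic Ω f) (hF : IsLocallyUnivalentHarmonic Ω F)
    (hdil : ¬ HasConstantDilatation Ω f) (hS : EqOn (schwarzian F) (schwarzian f) Ω) :
    ∃ R, IsAntiAnalyticRotation Ω f R ∧ IsAffinePostcomp Ω R F := by
  have hc : IsPreconnected Ω := hsc.isPathConnected.isConnected.isPreconnected
  obtain ⟨g, h, D⟩ := exists_decomposition_of_isLocallyUnivalentHarmonic hΩ hsc hf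
  obtain ⟨G, H, D'⟩ := exists_decomposition_of_isLocallyUnivalentHarmonic hΩ hsc hF
  have hJ := D.isLocallyUnivalentHarmonic_iff.1 hf
  obtain ⟨z₀, hz₀, hW⟩ := D.exists_wronskian_ne_zero hc hJ hdil
  obtain ⟨f₁, g₁, h₁, D₁, haff, hlt, hW₁⟩ := D.exists_sense_preserving hc hJ
  obtain ⟨F₁, G₁, H₁, D₁', haff', hlt', -⟩ :=
    D'.exists_sense_preserving hc (D'.isLocallyUnivalentHarmonic_iff.1 hF)
  obtain ⟨hf₁, hS₁⟩ := schwarzian_eqOn_of_affine_or_rotation hΩ hsc hf (Or.inl haff)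
  obtain ⟨hF₁, hS₁'⟩ := schwarzian_eqOn_of_affine_or_rotation hΩ hsc hF (Or.inl haff')
  obtain ⟨R₁, hR₁, hRF⟩ := D₁.exists_rotation_affine_of_sense_preserving hsc D₁' hlt hlt' hf₁ hF₁
    hz₀ (hW₁ z₀ hW) fun z hz => by rw [hS₁' hz, hS hz, hS₁ hz]
  obtain ⟨R, hR, hRR⟩ := haff.exists_rotation_comm hR₁
  exact ⟨R, hR, (hRR.trans hRF).trans haff'.symm⟩

/-- A map with constant dilatation is built from one holomorphic function. -/
theorem exists_isConstantDilatationMap (hΩ : IsOpen Ω) (hsc : IsSimplyConnected Ω)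
    (hf : IsLocallyUnivalentHarmonic Ω f) (hdil : HasConstantDilatation Ω f) :
    ∃ h : ℂ → ℂ, DifferentiableOn ℂ h Ω ∧ IsConstantDilatationMap Ω h f := by
  have hc : IsPreconnected Ω := hsc.isPathConnected.isConnected.isPreconnected
  obtain ⟨z₀, hz₀⟩ := hsc.nonempty
  obtain ⟨g, h, D⟩ := exists_decomposition_of_isLocallyUnivalentHarmonic hΩ hsc hf
  have hJ := D.isLocallyUnivalentHarmonic_iff.1 hf
  obtain ⟨s, t, hst, hrel⟩ := (D.hasConstantDilatation_iff hJ).1 hdil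
  by_cases ht : t = 0
  · subst ht
    have hs : s ≠ 0 := by simpa using hst
    obtain ⟨k, hk⟩ := exists_eq_const_mul_add_of_deriv hΩ hc D.right D.left (c := 0)
      fun z hz => by simpa [hs] using hrel z hz
    refine ⟨fun z => g z + conj k, D.left.add_const _, Or.inr fun z hz => ?_⟩
    rw [D.eq z hz, hk z hz]
    simp
  · have hd : ∀ z ∈ Ω, deriv g z = -s / t * deriv h z := fun z hz => by
      have := hrel z hz
      field_simp
      linear_combination this
    obtain ⟨k, hk⟩ := exists_eq_const_mul_add_of_deriv hΩ hc D.left D.right hd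
    refine ⟨h, D.right, Or.inl ⟨conj (-s / t), conj k, fun h1 => hJ z₀ hz₀ ?_, fun z hz => ?_⟩⟩
    · rw [RCLike.norm_conj] at h1
      rw [D.jacobian_eq hz₀, hd z₀ hz₀, norm_mul, h1, one_mul, sub_self]
    · rw [D.eq z hz, hk z hz]
      simp only [map_add, map_mul]
      ring

theorem IsConstantDilatationMap.isAffinePostcomp {k : ℂ → ℂ} (h : IsConstantDilatationMap Ω k F) :
    IsAffinePostcomp Ω k F := by
  rcases h with ⟨β, γ, hβ, h⟩ | h
  · exact ⟨β, 1, γ, by simpa using hβ, fun z hz => by rw [h z hz, one_mul]⟩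
  · exact ⟨1, 0, 0, by simp, fun z hz => by rw [h z hz]; ring⟩

/-- A holomorphic map as a harmonic map. -/
theorem decomposition_of_differentiableOn (hΩ : IsOpen Ω) (hh : DifferentiableOn ℂ h Ω) :
    Decomposition Ω h (fun _ => 0) h :=
  ⟨hΩ, differentiableOn_const 0, hh, fun z _ => by simp⟩

theorem isLocallyUnivalentHarmonic_iff_deriv_ne_zero (hΩ : IsOpen Ω)
    (hh : DifferentiableOn ℂ h Ω) :
    IsLocallyUnivalentHarmonic Ω h ↔ ∀ z ∈ Ω, deriv h z ≠ 0 := by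
  have D := decomposition_of_differentiableOn hΩ hh
  rw [D.isLocallyUnivalentHarmonic_iff]
  refine forall₂_congr fun z hz => ?_
  rw [D.jacobian_eq hz]
  simp

theorem schwarzian_eq_of_differentiableOn (hΩ : IsOpen Ω) (hh : DifferentiableOn ℂ h Ω)
    (h0 : ∀ z ∈ Ω, deriv h z ≠ 0) {z : ℂ} (hz : z ∈ Ω) :
    schwarzian h z = deriv (deriv (deriv h)) z / deriv h z -
      3 / 2 * (deriv (deriv h) z / deriv h z) ^ 2 := by
  have D := decomposition_of_differentiableOn hΩ hh
  rw [D.schwarzian_eq (D.isLocallyUnivalentHarmonic_iff.1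
    ((isLocallyUnivalentHarmonic_iff_deriv_ne_zero hΩ hh).2 h0)) hz, schwarzianKernel]
  have h1 : conj (deriv h z) ≠ 0 := by simpa using h0 z hz
  simp [mul_div_mul_right _ _ h1]

/-- If `f` is affinely equivalent to a holomorphic map, then so is each affine image of a rotation
`F` of `f`; in particular its dilatation is constant. -/
theorem hasConstantDilatation_of_rotation_affine {R : ℂ → ℂ} (hΩ : IsOpen Ω)
    (hF : IsLocallyUnivalentHarmonic Ω F) (hh : DifferentiableOn ℂ h Ω)
    (hR : IsAntiAnalyticRotation Ω F R) (hRh : IsAffinePostcomp Ω R h) :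
    HasConstantDilatation Ω F := by
  obtain ⟨G, H, hG, hH, heq, μ, hμ, hR⟩ := hR
  obtain ⟨a, b, c, hab, hRh⟩ := hRh
  have D : Decomposition Ω F G H := ⟨hΩ, hG, hH, heq⟩
  have D₁ := D.rotation hR
  have D₂ := D₁.affine hRh
  have hμ0 : μ ≠ 0 := by rintro rfl; simp at hμ
  refine (D.hasConstantDilatation_iff (D.isLocallyUnivalentHarmonic_iff.1 hF)).2
    ⟨conj a, conj b * conj μ, ?_, fun z hz => ?_⟩
  · by_contra! h0
    obtain ⟨ha, hb⟩ := h0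
    have ha' : a = 0 := by simpa using ha
    have hb' : b = 0 := by simpa [hμ0] using hb
    exact hab (by rw [ha', hb'])
  -- The z̄-derivative of the analytic h is zero; computed through F it gives the linear relation
  -- between H' and G'.
  · have h1 := (D₂.dzbar_eq hz).symm.trans ((decomposition_of_differentiableOn hΩ hh).dzbar_eq hz)
    rw [D₁.deriv_affine_left _ _ hz, ((hG.differentiableAt (hΩ.mem_nhds hz)).hasDerivAt.const_mul
      (conj μ)).deriv, deriv_const, map_zero, map_eq_zero] at h1
    rw [← h1]
    ring

end

end

end HarmonicMapping

open HarmonicMapping in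
theorem mainTheorem1 (Ω : Set ℂ) (hΩ : IsOpen Ω) (hsc : IsSimplyConnected Ω) (f : ℂ → ℂ)
    (hf : HarmonicMapping.IsLocallyUnivalentHarmonic Ω f) :
    -- both kinds of transformations preserve local univalence and `S_H`
    (∀ F : ℂ → ℂ,
      HarmonicMapping.IsAffinePostcomp Ω f F ∨ HarmonicMapping.IsAntiAnalyticRotation Ω f F →
        HarmonicMapping.IsLocallyUnivalentHarmonic Ω F ∧
          Set.EqOn (HarmonicMapping.schwarzian F) (HarmonicMapping.schwarzian f) Ω) ∧
    -- non-constant dilatation: the equality class consists of affine images of rotations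
    (¬ HarmonicMapping.HasConstantDilatation Ω f →
      ∀ F : ℂ → ℂ,
        (HarmonicMapping.IsLocallyUnivalentHarmonic Ω F ∧
            Set.EqOn (HarmonicMapping.schwarzian F) (HarmonicMapping.schwarzian f) Ω) ↔
          ∃ G : ℂ → ℂ, HarmonicMapping.IsAntiAnalyticRotation Ω f G ∧
            HarmonicMapping.IsAffinePostcomp Ω G F) ∧
    -- constant dilatation: the form of `f`, and the equality class of `f`
    (HarmonicMapping.HasConstantDilatation Ω f →
      (∃ h : ℂ → ℂ, DifferentiableOn ℂ h Ω ∧ HarmonicMapping.IsConstantDilatationMap Ω h f) ∧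
      ∀ h : ℂ → ℂ, DifferentiableOn ℂ h Ω → HarmonicMapping.IsConstantDilatationMap Ω h f →
        ∀ F : ℂ → ℂ,
          (HarmonicMapping.IsLocallyUnivalentHarmonic Ω F ∧
              Set.EqOn (HarmonicMapping.schwarzian F) (HarmonicMapping.schwarzian f) Ω) ↔
            ∃ k : ℂ → ℂ, HarmonicMapping.IsMobiusPostcomp Ω h k ∧
              HarmonicMapping.IsConstantDilatationMap Ω k F) := by
  refine ⟨fun F hF => schwarzian_eqOn_of_affine_or_rotation hΩ hsc hf hF, fun hdil F => ?_,
    fun hdil => ⟨exists_isConstantDilatationMap hΩ hsc hf hdil, fun h hh hfh F => ?_⟩⟩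
  · constructor
    · rintro ⟨hF, hS⟩
      exact exists_rotation_affine hΩ hsc hf hF hdil hS
    · rintro ⟨G, hG, hF⟩
      obtain ⟨hG', hSG⟩ := schwarzian_eqOn_of_affine_or_rotation hΩ hsc hf (Or.inr hG)
      obtain ⟨hF', hSF⟩ := schwarzian_eqOn_of_affine_or_rotation hΩ hsc hG' (Or.inl hF)
      exact ⟨hF', hSF.trans hSG⟩
  · obtain ⟨hhL, hSh⟩ :=
      schwarzian_eqOn_of_affine_or_rotation hΩ hsc hf (Or.inl hfh.isAffinePostcomp.symm)
    have hh0 := (isLocallyUnivalentHarmonic_iff_deriv_ne_zero hΩ hh).1 hhL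
    constructor
    · rintro ⟨hF, hS⟩
      -- Otherwise the non-constant case with f and F exchanged makes f, and with it the analytic h,
      -- an affine image of a rotation of F, which forces the dilatation of F to be constant.
      have hFdil : HasConstantDilatation Ω F := by
        by_contra hcon
        obtain ⟨R, hR, hRf⟩ := exists_rotation_affine hΩ hsc hF hf hcon hS.symm
        exact hcon (hasConstantDilatation_of_rotation_affine hΩ hF hh hR
          (hRf.trans hfh.isAffinePostcomp.symm))
      obtain ⟨k, hk, hFk⟩ := exists_isConstantDilatationMap hΩ hsc hF hFdil
      obtain ⟨hkL, hSk⟩ :=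
        schwarzian_eqOn_of_affine_or_rotation hΩ hsc hF (Or.inl hFk.isAffinePostcomp.symm)
      have hk0 := (isLocallyUnivalentHarmonic_iff_deriv_ne_zero hΩ hk).1 hkL
      refine ⟨k, isMobiusPostcomp_of_schwarzian_eq hΩ hsc hh hk hh0 hk0 fun z hz => ?_, hFk⟩
      rw [← schwarzian_eq_of_differentiableOn hΩ hk hk0 hz,
        ← schwarzian_eq_of_differentiableOn hΩ hh hh0 hz, hSk hz, hS hz, hSh hz]
    · rintro ⟨k, hk, hFk⟩
      obtain ⟨hkd, hk'⟩ := hk.schwarzian_eq hΩ hh hh0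
      have hk0 : ∀ z ∈ Ω, deriv k z ≠ 0 := fun z hz => (hk' z hz).1
      have hkL := (isLocallyUnivalentHarmonic_iff_deriv_ne_zero hΩ hkd).2 hk0
      obtain ⟨hF, hSF⟩ :=
        schwarzian_eqOn_of_affine_or_rotation hΩ hsc hkL (Or.inl hFk.isAffinePostcomp)
      refine ⟨hF, fun z hz => ?_⟩
      rw [hSF hz, schwarzian_eq_of_differentiableOn hΩ hkd hk0 hz, (hk' z hz).2,
        ← schwarzian_eq_of_differentiableOn hΩ hh hh0 hz, hSh hz]
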